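/- **Setting.** Let $1\le k\le n$ and $b_1,\dots,b_k>0$. *General case.* $\mathscr F=\mathscr F_{n,k}$ is the manifold of $k$-flags $V=(V_1\subset\dots\subset V_k)$ in $\mathbb R^n$, $\dim V_i=i$, and $d=k(2n-k-1)/2$. Let $A\in \mathrm{SL}(n,\mathbb R)$ be symmetric positive definite with $\mathbb R^n=E_1\oplus\dots\oplus E_n$ a decomposition in pairwise orthogonal eigenlines, $A|_{E_i}=\lambda_i$. Let $\pi=(\pi_1,\dots,\pi_k)$ be a sequence of distinct elements of $\{1,\dots,n\}$, $R(\pi)=\{\pi_1,\dots,\pi_k\}$. *Symplectic case.* $\mathscr F=\mathscr F^{sp}_{n,k}$ is the manifold of $k$-flags in $\mathbb R^{2n}$ with $V_k$ isotropic for $J=\begin{pmatrix}0&-I\\ I&0\end{pmatrix}$, and $d=k(2n-k)$. Let $A\in \mathrm{Sp}(n,\mathbb R)$ be symmetric positive definite with $\mathbb R^{2n}=E_1\oplus\dots\oplus E_{2n}$ a decomposition in pairwise orthogonal eigenlines, $A|_{E_i}=\lambda_i$, and $JE_i=E_{i+n}$ for $i\le n$. Write $\bar i=i+n \pmod{2n}$.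 Let $\pi=(\pi_1,\dots,\pi_k)$ be a sequence in $\{1,\dots,2n\}$ with entries distinct modulo $n$, $R(\pi)=\{\pi_1,\dots,\pi_k\}$. Put $V_\pi=(E_{\pi_1},\,E_{\pi_1}\oplus E_{\pi_2},\dots,\,E_{\pi_1}\oplus\dots\oplus E_{\pi_k})\in\mathscr F$ and $$Q_{A,b}(V)=\frac1k\sum_{i=1}^k\|Av_i\|^2=\frac1k\sum_{i=1}^k\langle A^tA\,v_i,v_i\rangle,\qquad v_i\in V_i\cap V_{i-1}^{\perp},\ \|v_i\|=b_i .$$ For sets of indices $P=(P_1,\dots,P_k)$ let $S_P$ be the set of flags $V\in\mathscr F$ with $V_i\cap V_{i-1}^\perp\subset\bigoplus_{a\in P_i}E_a$ for all $i$. The one-dimensional strata through $V_\pi$ are the following circles $S_P$ (with $P_s=\{\pi_s\}$ for all $s$ that are not mentioned). General case: 1. $P_i=\{\pi_i,j\}$, for $1\le i\le k$ and $j\notin R(\pi)$; 2. $P_i=P_j=\{\pi_i,\pi_j\}$, for $1\le i<j\le k$. Symplectic case: 1. $P_i=\{\pi_i,\overline{\pi_i}\}$, for $1\le i\le k$; 2.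 $P_i=\{\pi_i,j\}$, for $1\le i\le k$ and $j\notin R(\pi)\cup\overline{R(\pi)}$; 3. $P_i=P_j=\{\pi_i,\pi_j\}$, for $1\le i<j\le k$; 4. $P_i=\{\pi_i,\overline{\pi_j}\}$ and $P_j=\{\pi_j,\overline{\pi_i}\}$, for $1\le i<j\le k$. An *eigenvector basis* at $V_\pi$ is a basis of $T_{V_\pi}\mathscr F$ formed by one vector tangent to each of these circles. **Proposition (Hessian at the critical points).** $V_\pi$ is a critical point of $Q_{A,b}$ on $\mathscr F$, and $\dim T_{V_\pi}\mathscr F=d$. The Hessian of $Q_{A,b}$ at $V_\pi$ is diagonal with respect to any eigenvector basis. The velocities at $V_\pi$ of the circles, parametrized by the rotation angle in the planes $\bigoplus_{a\in P_i}E_a$, form an eigenvector basis, every eigenvector basis is obtained from it by multiplying the vectors by non-zero scalars $r$ (which multiplies the diagonal entries by $r^2$), and the diagonal entries of the Hessian in this basis are, in the general case, 1. $2k^{-1}b_i^2(\lambda_j^2-\lambda_{\pi_i}^2)$, 2. $2k^{-1}(b_i^2-b_j^2)(\lambda_{\pi_j}^2-\lambda_{\pi_i}^2)$, and, in the symplectic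 case, 1. $2k^{-1}b_i^2(\lambda_{\overline{\pi_i}}^2-\lambda_{\pi_i}^2)$, 2. $2k^{-1}b_i^2(\lambda_j^2-\lambda_{\pi_i}^2)$, 3. $2k^{-1}(b_i^2-b_j^2)(\lambda_{\pi_j}^2-\lambda_{\pi_i}^2)$, 4. $2k^{-1}\bigl(b_i^2(\lambda_{\overline{\pi_j}}^2-\lambda_{\pi_i}^2)+b_j^2(\lambda_{\overline{\pi_i}}^2-\lambda_{\pi_j}^2)\bigr)$, with indices as in the lists of circles. If $b_1>\dots>b_k$ and the eigenvalues of $A$ are distinct, then in the symplectic case there is also an eigenvector basis for which the entries in 4 are $2k^{-1}(b_i^2-b_j^2)(\lambda_{\overline{\pi_j}}^2-\lambda_{\pi_i}^2)$, the other entries being unchanged. Assume now that $b_1>\dots>b_k$, and that the eigenvalues are strictly decreasing: $\lambda_1>\dots>\lambda_n$ in the general case, and $\lambda_1>\dots>\lambda_n>\lambda_{2n}>\lambda_{2n-1}>\dots>\lambda_{n+1}$ in the symplectic case. Then, with respect to any eigenvector basis, exactly $H(\pi)$ of the diagonal entries are positive and exactly $d-H(\pi)$ are negative, where in the general case $$H(\pi)=\#\{(i,j):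 j\notin R(\pi),\ j<\pi_i\}+\#\{(i,j): i<j\le k,\ \pi_j<\pi_i\},$$ and in the symplectic case, for the order $1\triangleleft\dots\triangleleft n\triangleleft 2n\triangleleft 2n-1\triangleleft\dots\triangleleft n+1$, $H(\pi)=H^{sp}(\pi)$ is $$\#\{i:\overline{\pi_i}\triangleleft\pi_i\}+\#\{(i,j): j\notin R(\pi)\cup\overline{R(\pi)},\ j\triangleleft\pi_i\}+\#\{(i,j): i<j\le k,\ \pi_j\triangleleft\pi_i\}+\#\{(i,j): i<j\le k,\ \overline{\pi_j}\triangleleft\pi_i\}.$$ If the eigenvalues are strictly increasing in these orders instead, then exactly $H(\pi)$ entries are negative and exactly $d-H(\pi)$ are positive. -/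

import Mathlib

open scoped ContDiff
open Module

noncomputable section

/-! ## Flags -/

/-- A `k`-flag in the Euclidean space `ℝ^ι`: subspaces `V₁ ⊂ V₂ ⊂ … ⊂ V_k` with `dim V_i = i`.
The subspace `V_{i+1}` is `space i`, as `Fin k` starts at `0`. -/
structure KFlag (ι : Type) [Fintype ι] (k : ℕ) where
  space : Fin k → Submodule ℝ (EuclideanSpace ℝ ι)
  mono : Monotone space
  finrank_space : ∀ i, finrank ℝ (space i) = (i : ℕ) + 1

namespace KFlag

variable {ι : Type} [Fintype ι] {k : ℕ}

/-- The preceding subspace `V_{i-1}` of the flag (`0` for the first index). -/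
def below (V : KFlag ι k) (i : Fin k) : Submodule ℝ (EuclideanSpace ℝ ι) :=
  ⨆ j : Fin k, ⨆ _ : j < i, V.space j

/-- The line `V_i ⊖ V_{i-1}`, the orthogonal complement of `V_{i-1}` in `V_i`. -/
def line (V : KFlag ι k) (i : Fin k) : Submodule ℝ (EuclideanSpace ℝ ι) :=
  V.space i ⊓ (V.below i)ᗮ

theorem below_le (V : KFlag ι k) (i : Fin k) : V.below i ≤ V.space i :=
  iSup_le fun _ => iSup_le fun hj => V.mono hj.le

theorem finrank_below (V : KFlag ι k) (i : Fin k) : finrank ℝ (V.below i) = (i : ℕ) := by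
  obtain ⟨i, hi⟩ := i
  cases i with
  | zero =>
    have : V.below ⟨0, hi⟩ = ⊥ := by
      refine le_bot_iff.mp (iSup_le fun j => iSup_le fun hj => ?_)
      exact absurd (Fin.lt_def.mp hj) (Nat.not_lt_zero _)
    rw [this, finrank_bot]
  | succ m =>
    have : V.below ⟨m + 1, hi⟩ = V.space ⟨m, by omega⟩ := by
      refine le_antisymm (iSup_le fun j => iSup_le fun hj => V.mono ?_) ?_
      · exact Fin.le_def.mpr (Nat.lt_succ_iff.mp (Fin.lt_def.mp hj))
      · exact le_iSup_of_le ⟨m, by omega⟩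
          (le_iSup_of_le (Fin.lt_def.mpr (Nat.lt_succ_self m)) le_rfl)
    rw [this, V.finrank_space]

theorem finrank_line (V : KFlag ι k) (i : Fin k) : finrank ℝ (V.line i) = 1 := by
  have h := Submodule.finrank_add_inf_finrank_orthogonal (V.below_le i)
  rw [V.finrank_below, V.finrank_space, inf_comm] at h
  have h' : finrank ℝ (V.line i) = finrank ℝ ↥(V.space i ⊓ (V.below i)ᗮ) := rfl
  omega

theorem exists_unit (V : KFlag ι k) (i : Fin k) : ∃ v ∈ V.line i, ‖v‖ = 1 := by
  have : Nontrivial (V.line i) :=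
    Module.nontrivial_of_finrank_pos (R := ℝ) (by rw [V.finrank_line]; exact one_pos)
  obtain ⟨v, hv⟩ := exists_norm_eq (V.line i) (c := 1) zero_le_one
  exact ⟨v, v.2, hv⟩

/-- A unit vector in `V_i ⊖ V_{i-1}`; it is unique up to its sign. -/
def unitVec (V : KFlag ι k) (i : Fin k) : EuclideanSpace ℝ ι := (V.exists_unit i).choose

theorem unitVec_mem (V : KFlag ι k) (i : Fin k) : V.unitVec i ∈ V.line i :=
  (V.exists_unit i).choose_spec.1

theorem norm_unitVec (V : KFlag ι k) (i : Fin k) : ‖V.unitVec i‖ = 1 :=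
  (V.exists_unit i).choose_spec.2

/-- `X` is an orthonormal frame adapted to the flag `V`, that is, `V_i` is the span of the first
`i` columns of `X`. -/
def IsFrame (X : Fin k → EuclideanSpace ℝ ι) (V : KFlag ι k) : Prop :=
  Orthonormal ℝ X ∧ ∀ i, V.space i = Submodule.span ℝ (X '' Set.Iic i)

/-- The flag of an orthonormal frame. -/
def ofFrame (X : Fin k → EuclideanSpace ℝ ι) (hX : Orthonormal ℝ X) : KFlag ι k where
  space i := Submodule.span ℝ (X '' Set.Iic i)
  mono _ _ hij := Submodule.span_mono (Set.image_mono (Set.Iic_subset_Iic.mpr hij))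
  finrank_space i := by
    have h := finrank_span_set_eq_card (R := ℝ)
      ((hX.linearIndependent.linearIndepOn (s := Set.Iic i)).id_image)
    rw [h, Set.toFinset_card, Set.card_image_of_injective _ hX.linearIndependent.injective]
    simp

theorem isFrame_ofFrame (X : Fin k → EuclideanSpace ℝ ι) (hX : Orthonormal ℝ X) :
    IsFrame X (ofFrame X hX) := ⟨hX, fun _ => rfl⟩

/-- The standard embedding of the flag manifold in a linear space: a flag is sent to the tuple of
the orthogonal projections onto its subspaces. The smooth structure of the flag manifold is the
one induced by this embedding. -/
def proj (V : KFlag ι k) : Fin k → (EuclideanSpace ℝ ι →L[ℝ] EuclideanSpace ℝ ι) :=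
  fun i => (V.space i).starProjection

/-! ## Smooth curves, tangent spaces, critical points and Hessians -/

/-- `γ` is a smooth curve in the set `S` of flags with `γ 0 = V`. -/
def IsSmoothCurve (S : Set (KFlag ι k)) (V : KFlag ι k) (γ : ℝ → KFlag ι k) : Prop :=
  γ 0 = V ∧ (∀ t, γ t ∈ S) ∧ ContDiff ℝ ∞ fun t => (γ t).proj

/-- The tangent space at `V` of a submanifold `S` of the flag manifold: the space of the
velocities of the smooth curves in `S` through `V`. -/
def tangentSpace (S : Set (KFlag ι k)) (V : KFlag ι k) :
    Submodule ℝ (Fin k → (EuclideanSpace ℝ ι →L[ℝ] EuclideanSpace ℝ ι)) :=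
  Submodule.span ℝ {w | ∃ γ, IsSmoothCurve S V γ ∧ HasDerivAt (fun t => (γ t).proj) w 0}

/-- `V` is a critical point of `f` on the submanifold `S`. -/
def IsCriticalAt (S : Set (KFlag ι k)) (f : KFlag ι k → ℝ) (V : KFlag ι k) : Prop :=
  ∀ γ, IsSmoothCurve S V γ → HasDerivAt (fun t => f (γ t)) 0 0

/-- `B` is the Hessian at the critical point `V` of the function `f` on the submanifold `S`: the
symmetric bilinear form on the tangent space with `B(γ'(0), γ'(0)) = (f ∘ γ)''(0)` for all smooth
curves `γ` in `S` through `V`. -/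
def IsHessianAt (S : Set (KFlag ι k)) (f : KFlag ι k → ℝ) (V : KFlag ι k)
    (B : LinearMap.BilinForm ℝ (tangentSpace S V)) : Prop :=
  B.IsSymm ∧
  ∀ γ, IsSmoothCurve S V γ → ∀ w : tangentSpace S V, HasDerivAt (fun t => (γ t).proj) w.1 0 →
    ContDiffAt ℝ 2 (fun t => f (γ t)) 0 ∧ iteratedDeriv 2 (fun t => f (γ t)) 0 = B w w

/-! ## The quadratic functions -/

/-- `Q_{M,b}(V) = k⁻¹ ∑ ⟨M v_i, v_i⟩` where `v_i ∈ V_i ⊖ V_{i-1}` has norm `b_i`. -/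
def quadFun [DecidableEq ι] (M : Matrix ι ι ℝ) (b : Fin k → ℝ) (V : KFlag ι k) : ℝ :=
  (k : ℝ)⁻¹ * ∑ i, inner ℝ (M.toEuclideanLin (b i • V.unitVec i)) (b i • V.unitVec i)

/-- The value of `Q_{M,b}` does not depend on the vectors `v_i`. -/
theorem quadFun_eq [DecidableEq ι] (M : Matrix ι ι ℝ) (b : Fin k → ℝ) (V : KFlag ι k)
    (v : Fin k → EuclideanSpace ℝ ι) (hv : ∀ i, v i ∈ V.line i) (hb : ∀ i, ‖v i‖ = b i) :
    quadFun M b V = (k : ℝ)⁻¹ * ∑ i, inner ℝ (M.toEuclideanLin (v i)) (v i) := by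
  unfold quadFun
  congr 1
  refine Finset.sum_congr rfl fun i _ => ?_
  have hne : (⟨V.unitVec i, V.unitVec_mem i⟩ : V.line i) ≠ 0 := by
    intro h
    have h0 : V.unitVec i = 0 := congrArg Subtype.val h
    have h1 := V.norm_unitVec i
    rw [h0, norm_zero] at h1
    exact zero_ne_one h1
  obtain ⟨c, hc⟩ := (finrank_eq_one_iff_of_nonzero' _ hne).mp (V.finrank_line i) ⟨v i, hv i⟩
  have hc' : v i = c • V.unitVec i := (congrArg Subtype.val hc).symm
  have hcb : |c| = b i := by
    rw [← hb i, hc', norm_smul, V.norm_unitVec, mul_one, Real.norm_eq_abs]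
  rw [hc', ← hcb]
  simp only [map_smul, inner_smul_left, inner_smul_right, conj_trivial]
  rw [← mul_assoc, ← mul_assoc, abs_mul_abs_self]

/-! ## Strata -/

/-- The stratum of a sequence `P₁, …, P_k` of sets of indices: the flags spanned by the orthonormal
frames `X` with `X_i` in the span `E_{P_i}` of the directions with index in `P_i`. -/
def stratum (u : OrthonormalBasis ι ℝ (EuclideanSpace ℝ ι)) (P : Fin k → Set ι) :
    Set (KFlag ι k) :=
  {V | ∃ X, IsFrame X V ∧ ∀ i, X i ∈ Submodule.span ℝ (u '' P i)}

/-- The coordinate flag `V_π = (E_{π₁}, E_{π₁} ⊕ E_{π₂}, …)`. -/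
def coordFlag (u : OrthonormalBasis ι ℝ (EuclideanSpace ℝ ι)) (π : Fin k ↪ ι) : KFlag ι k :=
  ofFrame (fun i => u (π i)) (u.orthonormal.comp π π.injective)

/-- An eigenvector basis: a basis of the tangent space of `S` at `V` whose vectors are tangent to
the given one-dimensional strata. -/
def IsEigenvectorBasis {Λ : Type} (S : Set (KFlag ι k)) (V : KFlag ι k)
    (str : Λ → Set (KFlag ι k)) (w : Basis Λ ℝ (tangentSpace S V)) : Prop :=
  ∀ x, (w x).1 ∈ tangentSpace (str x) V

/-! ## The general flag manifold -/

section General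

variable {n : ℕ}

/-- The indices of the one-dimensional strata through `V_π`: the pairs `(i, j)` with `j` not among
`π₁, …, π_k`, and the pairs `i < j`. -/
abbrev Link (π : Fin k ↪ Fin n) : Type :=
  {p : Fin k × Fin n // p.2 ∉ Set.range π} ⊕ {p : Fin k × Fin k // p.1 < p.2}

/-- The sets `P₁, …, P_k` of the stratum joining `V_π` to the coordinate flag where `π_i` is
replaced by `j` (first case), or where `π_i` and `π_j` are switched (second case). -/
def linkSets (π : Fin k ↪ Fin n) : Link π → Fin k → Set (Fin n)
  | .inl p => Function.update (fun s => {π s}) p.1.1 {π p.1.1, p.1.2}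
  | .inr p => Function.update (Function.update (fun s => {π s}) p.1.1 {π p.1.1, π p.1.2})
      p.1.2 {π p.1.1, π p.1.2}

/-- The stratum, a circle through `V_π`, parametrized by the rotation angle. -/
def linkFrame (u : OrthonormalBasis (Fin n) ℝ (EuclideanSpace ℝ (Fin n))) (π : Fin k ↪ Fin n) :
    Link π → ℝ → Fin k → EuclideanSpace ℝ (Fin n)
  | .inl p, t => Function.update (fun s => u (π s)) p.1.1
      (Real.cos t • u (π p.1.1) + Real.sin t • u p.1.2)
  | .inr p, t => Function.update (Function.update (fun s => u (π s))
      p.1.1 (Real.cos t • u (π p.1.1) + Real.sin t • u (π p.1.2)))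
      p.1.2 (Real.cos t • u (π p.1.2) - Real.sin t • u (π p.1.1))

/-- The eigenvalues of the Hessian. -/
def linkValue (lam : Fin n → ℝ) (b : Fin k → ℝ) (π : Fin k ↪ Fin n) : Link π → ℝ
  | .inl p => 2 * (k : ℝ)⁻¹ * b p.1.1 ^ 2 * (lam p.1.2 ^ 2 - lam (π p.1.1) ^ 2)
  | .inr p => 2 * (k : ℝ)⁻¹ * (b p.1.1 ^ 2 - b p.1.2 ^ 2) *
      (lam (π p.1.2) ^ 2 - lam (π p.1.1) ^ 2)

/-- The inversion count `H(π)`. -/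
def inversionCount (π : Fin k ↪ Fin n) : ℕ :=
  Nat.card {p : Fin k × Fin n // p.2 ∉ Set.range π ∧ p.2 < π p.1} +
  Nat.card {p : Fin k × Fin k // p.1 < p.2 ∧ π p.2 < π p.1}

end General

/-! ## The isotropic flag manifold

The index set of `ℝ^{2n}` is `Fin n ⊕ Fin n`; the index `i ≤ n` is `inl i`, the index `i + n` is
`inr i`, and the conjugate of an index `a` is `a.swap`. -/

section Symplectic

variable {n : ℕ}

/-- The complex structure of `ℝ^{2n}`, with matrix `(0, -I; I, 0)`. -/
def complexStr (n : ℕ) :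
    EuclideanSpace ℝ (Fin n ⊕ Fin n) →ₗ[ℝ] EuclideanSpace ℝ (Fin n ⊕ Fin n) :=
  (Matrix.J (Fin n) ℝ).toEuclideanLin

/-- The isotropic `k`-flags in `ℝ^{2n}`. -/
def isotropicFlags (n k : ℕ) : Set (KFlag (Fin n ⊕ Fin n) k) :=
  {V | ∀ i, ∀ x ∈ V.space i, ∀ y ∈ V.space i, inner ℝ x (complexStr n y) = 0}

/-- The order `1 ◁ 2 ◁ ⋯ ◁ n ◁ 2n ◁ 2n - 1 ◁ ⋯ ◁ n + 1`. -/
def SpLT : Fin n ⊕ Fin n → Fin n ⊕ Fin n → Prop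
  | .inl i, .inl j => i < j
  | .inl _, .inr _ => True
  | .inr _, .inl _ => False
  | .inr i, .inr j => j < i

/-- Isotropic permutations: the residues of `π₁, …, π_k` modulo `n` are distinct. -/
def IsIsotropic (π : Fin k ↪ Fin n ⊕ Fin n) : Prop :=
  Function.Injective fun i => (π i).elim id id

/-- The indices of the one-dimensional strata through `V_π`: the indices `i`; the pairs `(i, j)`
with `j` neither among `π₁, …, π_k` nor among their conjugates; and twice the pairs `i < j`. -/
abbrev SpLink (π : Fin k ↪ Fin n ⊕ Fin n) : Type :=
  (Fin k ⊕
    {p : Fin k × (Fin n ⊕ Fin n) // p.2 ∉ Set.range π ∧ p.2.swap ∉ Set.range π}) ⊕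
  ({p : Fin k × Fin k // p.1 < p.2} ⊕ {p : Fin k × Fin k // p.1 < p.2})

/-- The sets `P₁, …, P_k` of the stratum joining `V_π` to the coordinate flag obtained by:
replacing `π_i` by its conjugate; replacing `π_i` by `j`; switching `π_i` and `π_j`;
replacing `π_i` by the conjugate of `π_j` and `π_j` by the conjugate of `π_i`. -/
def spLinkSets (π : Fin k ↪ Fin n ⊕ Fin n) : SpLink π → Fin k → Set (Fin n ⊕ Fin n)
  | .inl (.inl i) => Function.update (fun s => {π s}) i {π i, (π i).swap}
  | .inl (.inr p) => Function.update (fun s => {π s}) p.1.1 {π p.1.1, p.1.2}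
  | .inr (.inl p) => Function.update (Function.update (fun s => {π s})
      p.1.1 {π p.1.1, π p.1.2}) p.1.2 {π p.1.1, π p.1.2}
  | .inr (.inr p) => Function.update (Function.update (fun s => {π s})
      p.1.1 {π p.1.1, (π p.1.2).swap}) p.1.2 {π p.1.2, (π p.1.1).swap}

/-- The symplectic stratum, a circle through `V_π`, parametrized by the rotation angle. In the last
case the sign is determined by isotropy; recall that `J u_a` is `u` at the conjugate of `a`, up to
its sign. -/
def spLinkFrame (u : OrthonormalBasis (Fin n ⊕ Fin n) ℝ (EuclideanSpace ℝ (Fin n ⊕ Fin n)))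
    (π : Fin k ↪ Fin n ⊕ Fin n) :
    SpLink π → ℝ → Fin k → EuclideanSpace ℝ (Fin n ⊕ Fin n)
  | .inl (.inl i), t => Function.update (fun s => u (π s)) i
      (Real.cos t • u (π i) + Real.sin t • u (π i).swap)
  | .inl (.inr p), t => Function.update (fun s => u (π s)) p.1.1
      (Real.cos t • u (π p.1.1) + Real.sin t • u p.1.2)
  | .inr (.inl p), t => Function.update (Function.update (fun s => u (π s))
      p.1.1 (Real.cos t • u (π p.1.1) + Real.sin t • u (π p.1.2)))
      p.1.2 (Real.cos t • u (π p.1.2) - Real.sin t • u (π p.1.1))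
  | .inr (.inr p), t => Function.update (Function.update (fun s => u (π s))
      p.1.1 (Real.cos t • u (π p.1.1) + Real.sin t • complexStr n (u (π p.1.2))))
      p.1.2 (Real.cos t • u (π p.1.2) + Real.sin t • complexStr n (u (π p.1.1)))

/-- The eigenvalues of the Hessian in the symplectic case. -/
def spLinkValue (lam : Fin n ⊕ Fin n → ℝ) (b : Fin k → ℝ) (π : Fin k ↪ Fin n ⊕ Fin n) :
    SpLink π → ℝ
  | .inl (.inl i) => 2 * (k : ℝ)⁻¹ * b i ^ 2 * (lam (π i).swap ^ 2 - lam (π i) ^ 2)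
  | .inl (.inr p) => 2 * (k : ℝ)⁻¹ * b p.1.1 ^ 2 * (lam p.1.2 ^ 2 - lam (π p.1.1) ^ 2)
  | .inr (.inl p) => 2 * (k : ℝ)⁻¹ * (b p.1.1 ^ 2 - b p.1.2 ^ 2) *
      (lam (π p.1.2) ^ 2 - lam (π p.1.1) ^ 2)
  | .inr (.inr p) => 2 * (k : ℝ)⁻¹ *
      (b p.1.1 ^ 2 * (lam (π p.1.2).swap ^ 2 - lam (π p.1.1) ^ 2) +
        b p.1.2 ^ 2 * (lam (π p.1.1).swap ^ 2 - lam (π p.1.2) ^ 2))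

/-- The same values with those of the last family rescaled by a positive factor. -/
def spLinkValueRescaled (lam : Fin n ⊕ Fin n → ℝ) (b : Fin k → ℝ) (π : Fin k ↪ Fin n ⊕ Fin n) :
    SpLink π → ℝ
  | .inr (.inr p) => 2 * (k : ℝ)⁻¹ * (b p.1.1 ^ 2 - b p.1.2 ^ 2) *
      (lam (π p.1.2).swap ^ 2 - lam (π p.1.1) ^ 2)
  | x => spLinkValue lam b π x

/-- The symplectic inversion count `H^{sp}(π)`. -/
def spInversionCount (π : Fin k ↪ Fin n ⊕ Fin n) : ℕ :=
  Nat.card {i : Fin k // SpLT (π i).swap (π i)} +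
  Nat.card {p : Fin k × (Fin n ⊕ Fin n) //
    p.2 ∉ Set.range π ∧ p.2.swap ∉ Set.range π ∧ SpLT p.2 (π p.1)} +
  Nat.card {p : Fin k × Fin k // p.1 < p.2 ∧ SpLT (π p.2) (π p.1)} +
  Nat.card {p : Fin k × Fin k // p.1 < p.2 ∧ SpLT (π p.2).swap (π p.1)}

end Symplectic

end KFlag

end

noncomputable section

namespace KFlag

open Filter Topology

section Frames

variable {ι : Type} [Fintype ι] {k : ℕ}

/-! ## Adapted frames -/

/-! Near `t = 0`, a smooth curve of flags through `V_π` lifts to a smooth curve of adapted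
orthonormal frames `X` (`exists_frame_of_curve`), and on frames the function is the weighted sum of
the `⟨M X_i, X_i⟩` with `M = AᵗA`. Since `X_i` is a unit vector and `X_i(0)` is an eigenvector with
eigenvalue `μ_i`, each term is `μ_i + ⟨(M - μ_i) X_i, X_i⟩`. Its first derivative at `0` vanishes
and its second is `2⟨(M - μ_i) Y_i, Y_i⟩` with `Y = X'(0)`, free of accelerations
(`quadratic_along_curve`). So `V_π` is critical and the Hessian is the explicit form `hform` in `Y`.

The possible `Y` form a linear space: the Gram matrix of the frame is constant, and in the
symplectic case so are the values of the symplectic form. Conversely each such `Y` is the derivative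
of `exp(tZ) e`, with `Z` skew and, if needed, commuting with `J` (`exists_skew`,
`exists_skew_commuting`). The map `vel` carries this space isomorphically to the tangent space
(`unvel_vel`).

Each circle moves a line `π_i` towards a direction `a`, its key `(i, a)`. The coordinates of `Y` at
the keys are dual to the velocities of the circles, and vectors tangent to one circle have only one
non-zero coordinate. Hence eigenvector bases are rescalings of the basis of velocities, and pairing
a circle direction with any `Y` gives a constant times the dual coordinate, so the Hessian is
diagonal. The structure `StratumSystem` derives all this for both cases at once.

For decreasing `b`, each diagonal entry is a positive multiple of `λ_a² - λ_{π_i}²` at its key. For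
the fourth symplectic family this uses `λ_a λ_{ā} = 1`. The signs are then decided by counting the
keys that are inversions. -/

theorem IsFrame.mem_line {X : Fin k → EuclideanSpace ℝ ι} {V : KFlag ι k} (h : IsFrame X V)
    (i : Fin k) : X i ∈ V.line i := by
  refine Submodule.mem_inf.mpr ⟨?_, ?_⟩
  · rw [h.2 i]
    exact Submodule.subset_span ⟨i, le_refl i, rfl⟩
  · rw [below, Submodule.mem_orthogonal]
    intro y hy
    refine Submodule.iSup_induction (motive := fun y => inner ℝ y (X i) = 0) _ hy ?_ ?_ ?_
    · intro j z hz
      refine Submodule.iSup_induction (motive := fun y => inner ℝ y (X i) = 0) _ hz ?_ ?_ ?_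
      · intro hj z hz
        rw [h.2 j] at hz
        induction hz using Submodule.span_induction with
        | mem x hx =>
          obtain ⟨s, hs, rfl⟩ := hx
          exact h.1.2 (lt_of_le_of_lt hs hj).ne
        | zero => simp
        | add x y _ _ hx hy => rw [inner_add_left, hx, hy, add_zero]
        | smul c x _ hx => rw [inner_smul_left, hx, mul_zero]
      · simp
      · intro x y hx hy
        rw [inner_add_left, hx, hy, add_zero]
    · simp
    · intro x y hx hy
      rw [inner_add_left, hx, hy, add_zero]

/-- For `i < j` the line of index `j` is orthogonal to `V.below j`, which contains `X i`. The spans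
then agree with the flag by dimension. -/
theorem isFrame_of_mem_line {X : Fin k → EuclideanSpace ℝ ι} {V : KFlag ι k}
    (hX : ∀ i, X i ∈ V.line i) (hn : ∀ i, ‖X i‖ = 1) : IsFrame X V := by
  have key : ∀ i j, i < j → inner ℝ (X i) (X j) = 0 := fun i j hij =>
    Submodule.inner_right_of_mem_orthogonal
      (Submodule.mem_iSup_of_mem i (Submodule.mem_iSup_of_mem hij (hX i).1)) (hX j).2
  have ho : Orthonormal ℝ X := by
    refine ⟨hn, fun i j hij => ?_⟩
    rcases lt_or_gt_of_ne hij with h | h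
    · exact key i j h
    · rw [real_inner_comm]
      exact key j i h
  refine ⟨ho, fun i => ?_⟩
  refine (Submodule.eq_of_le_of_finrank_eq ?_ ?_).symm
  · rw [Submodule.span_le]
    rintro _ ⟨s, hs, rfl⟩
    exact V.mono hs (hX s).1
  · rw [V.finrank_space]
    exact (ofFrame X ho).finrank_space i

theorem IsFrame.eq_smul {X X' : Fin k → EuclideanSpace ℝ ι} {V : KFlag ι k} (h : IsFrame X V)
    (h' : IsFrame X' V) (i : Fin k) : ∃ c : ℝ, X' i = c • X i := by
  have hne : (⟨X i, h.mem_line i⟩ : V.line i) ≠ 0 := fun h0 =>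
    h.1.ne_zero i (congrArg Subtype.val h0)
  obtain ⟨c, hc⟩ := (finrank_eq_one_iff_of_nonzero' _ hne).mp (V.finrank_line i)
    ⟨X' i, h'.mem_line i⟩
  exact ⟨c, (congrArg Subtype.val hc).symm⟩

/-- Membership in a stratum provides one frame in the prescribed spans. Two frames of the same flag
are proportional column by column, so every frame lies in these spans. -/
theorem IsFrame.mem_span_of_mem_stratum {u : OrthonormalBasis ι ℝ (EuclideanSpace ℝ ι)}
    {P : Fin k → Set ι} {X : Fin k → EuclideanSpace ℝ ι} {V : KFlag ι k} (h : IsFrame X V)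
    (hV : V ∈ stratum u P) (i : Fin k) : X i ∈ Submodule.span ℝ (u '' P i) := by
  obtain ⟨X', h', hX'⟩ := hV
  obtain ⟨c, hc⟩ := h'.eq_smul h i
  rw [hc]
  exact Submodule.smul_mem _ _ (hX' i)

theorem inner_eq_zero_of_mem_span_image (u : OrthonormalBasis ι ℝ (EuclideanSpace ℝ ι))
    {P : Set ι} {x : EuclideanSpace ℝ ι} (hx : x ∈ Submodule.span ℝ (u '' P)) {a : ι}
    (ha : a ∉ P) : inner ℝ (u a) x = 0 := by
  induction hx using Submodule.span_induction with
  | mem x hx =>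
    obtain ⟨s, hs, rfl⟩ := hx
    exact u.orthonormal.2 fun h => ha (h ▸ hs)
  | zero => simp
  | add x y _ _ hx hy => rw [inner_add_right, hx, hy, add_zero]
  | smul c x _ hx => rw [inner_smul_right, hx, mul_zero]

theorem quadFun_eq_of_isFrame [DecidableEq ι] (M : Matrix ι ι ℝ) {b : Fin k → ℝ}
    (hb : ∀ i, 0 < b i) {V : KFlag ι k} {X : Fin k → EuclideanSpace ℝ ι} (h : IsFrame X V) :
    quadFun M b V = (k : ℝ)⁻¹ * ∑ i, b i ^ 2 * inner ℝ (M.toEuclideanLin (X i)) (X i) := by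
  rw [quadFun_eq M b V (fun i => b i • X i)
    (fun i => Submodule.smul_mem _ _ (h.mem_line i)) fun i => by
      rw [norm_smul, h.1.1 i, mul_one, Real.norm_of_nonneg (hb i).le]]
  congr 1
  refine Finset.sum_congr rfl fun i _ => ?_
  rw [map_smul, real_inner_smul_left, real_inner_smul_right]
  ring

/-! ## Projections in terms of frames -/

section Rank

variable {E : Type*} [NormedAddCommGroup E] [InnerProductSpace ℝ E]

/-- The bilinear map `(x, y) ↦ ⟨x, ·⟩ y`. -/
def rk : E →L[ℝ] E →L[ℝ] (E →L[ℝ] E) :=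
  LinearMap.mkContinuous₂ (LinearMap.mk₂ ℝ (fun x y => (innerSL ℝ x).smulRight y)
    (fun x x' y => by ext1 v; simp [add_smul])
    (fun c x y => by ext1 v; simp [smul_smul])
    (fun x y y' => by ext1 v; simp)
    (fun c x y => by ext1 v; simp [smul_smul, mul_comm])) 1
    (fun x y => by
      refine ContinuousLinearMap.opNorm_le_bound _ (by positivity) fun v => ?_
      simp only [LinearMap.mk₂_apply, ContinuousLinearMap.smulRight_apply, innerSL_apply_apply,
        norm_smul, one_mul]
      calc _ ≤ (‖x‖ * ‖v‖) * ‖y‖ := by gcongr; exact norm_inner_le_norm x v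
        _ = _ := by ring)

@[simp]
theorem rk_apply (x y v : E) : rk x y v = (inner ℝ x v : ℝ) • y := by
  simp [rk]

-- From here on only `rk_apply` and the continuous bilinearity of `rk` matter.
attribute [irreducible] rk

theorem hasDerivAt_rk {x : ℝ → E} {y : E} {t : ℝ} (h : HasDerivAt x y t) :
    HasDerivAt (fun t => rk (x t) (x t)) (rk y (x t) + rk (x t) y) t := by
  have h2 := (rk (E := E)).hasDerivAt_of_bilinear (fun _ => h) (fun _ => h)
  rwa [add_comm] at h2

theorem contDiff_rk {x : ℝ → E} (h : ContDiff ℝ ∞ x) : ContDiff ℝ ∞ fun t => rk (x t) (x t) :=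
  (rk (E := E)).isBoundedBilinearMap.contDiff.comp (h.prodMk h)

theorem contDiff_clm_apply_const {x : ℝ → E →L[ℝ] E} (h : ContDiff ℝ ∞ x) (v : E) :
    ContDiff ℝ ∞ fun t => x t v :=
  h.clm_apply contDiff_const

end Rank

/-- The projections on the spans of the first vectors of a frame. -/
def frameProj (X : Fin k → EuclideanSpace ℝ ι) :
    Fin k → (EuclideanSpace ℝ ι →L[ℝ] EuclideanSpace ℝ ι) :=
  fun i => ∑ s ∈ Finset.Iic i, rk (X s) (X s)

/-- The derivative of `frameProj` at `e`. -/
def vel (e : Fin k → EuclideanSpace ℝ ι) :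
    (Fin k → EuclideanSpace ℝ ι) →ₗ[ℝ]
      (Fin k → (EuclideanSpace ℝ ι →L[ℝ] EuclideanSpace ℝ ι)) where
  toFun Y := fun i => ∑ s ∈ Finset.Iic i, (rk (Y s) (e s) + rk (e s) (Y s))
  map_add' Y Y' := by
    funext i
    simp only [Pi.add_apply, map_add, _root_.add_apply, ← Finset.sum_add_distrib]
    exact Finset.sum_congr rfl fun s _ => by abel
  map_smul' c Y := by
    funext i
    simp [Finset.smul_sum]

theorem vel_apply (e Y : Fin k → EuclideanSpace ℝ ι) (i : Fin k) :
    vel e Y i = ∑ s ∈ Finset.Iic i, (rk (Y s) (e s) + rk (e s) (Y s)) := rfl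

/-- The projection on the span of orthonormal vectors is the sum of the rank-one projections. This
transfers smoothness and derivatives from frames to flags. -/
theorem IsFrame.proj_eq {X : Fin k → EuclideanSpace ℝ ι} {V : KFlag ι k} (h : IsFrame X V) :
    V.proj = frameProj X := by
  funext i
  ext1 v
  refine Submodule.eq_starProjection_of_mem_of_inner_eq_zero (K := V.space i) ?_ ?_
  · rw [frameProj, _root_.sum_apply]
    refine Submodule.sum_mem _ fun s hs => ?_
    rw [rk_apply]
    exact Submodule.smul_mem _ _ (V.mono (Finset.mem_Iic.mp hs) (h.mem_line s).1)
  · intro y hy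
    rw [h.2 i] at hy
    induction hy using Submodule.span_induction with
    | mem x hx =>
      obtain ⟨r, hr, rfl⟩ := hx
      simp only [frameProj, _root_.sum_apply, rk_apply, inner_sub_left, sum_inner,
        real_inner_smul_left]
      rw [Finset.sum_eq_single r]
      · rw [real_inner_self_eq_norm_sq, h.1.1 r, real_inner_comm]
        ring
      · intro s _ hs
        rw [h.1.2 hs, mul_zero]
      · intro hr'
        exact absurd (Finset.mem_Iic.mpr hr) hr'
    | zero => simp
    | add x y _ _ hx hy => rw [inner_add_right, hx, hy, add_zero]
    | smul c x _ hx => rw [inner_smul_right, hx, mul_zero]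

theorem hasDerivAt_frameProj {X : ℝ → Fin k → EuclideanSpace ℝ ι}
    {Y : Fin k → EuclideanSpace ℝ ι} {t : ℝ} (h : HasDerivAt X Y t) :
    HasDerivAt (fun t => frameProj (X t)) (vel (X t) Y) t := by
  rw [hasDerivAt_pi] at h ⊢
  intro i
  refine HasDerivAt.fun_sum fun s _ => ?_
  exact hasDerivAt_rk (h s)

theorem contDiff_frameProj {X : ℝ → Fin k → EuclideanSpace ℝ ι} (h : ContDiff ℝ ∞ X) :
    ContDiff ℝ ∞ fun t => frameProj (X t) := by
  rw [contDiff_pi] at h ⊢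
  intro i
  refine ContDiff.sum fun s _ => ?_
  exact contDiff_rk (h s)

/-! ## Frames along smooth curves -/

/-- The alternative depends only on `i`, not on the flag, so that along a curve the projection on
`below i` is either constantly zero or a component of `proj`. -/
theorem below_eq (i : Fin k) : (∀ V : KFlag ι k, V.below i = ⊥) ∨
    ∃ j, j < i ∧ ∀ V : KFlag ι k, V.below i = V.space j := by
  obtain ⟨i, hi⟩ := i
  cases i with
  | zero =>
    left
    intro V
    refine le_bot_iff.mp (iSup_le fun j => iSup_le fun hj => ?_)
    exact absurd (Fin.lt_def.mp hj) (Nat.not_lt_zero _)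
  | succ m =>
    refine Or.inr ⟨⟨m, by omega⟩, Fin.lt_def.mpr (Nat.lt_succ_self m), fun V => ?_⟩
    refine le_antisymm (iSup_le fun j => iSup_le fun hj => V.mono ?_) ?_
    · exact Fin.le_def.mpr (Nat.lt_succ_iff.mp (Fin.lt_def.mp hj))
    · exact le_iSup_of_le ⟨m, by omega⟩
        (le_iSup_of_le (Fin.lt_def.mpr (Nat.lt_succ_self m)) le_rfl)

theorem contDiff_below {γ : ℝ → KFlag ι k} (h : ContDiff ℝ ∞ fun t => (γ t).proj) (i : Fin k) :
    ContDiff ℝ ∞ fun t => ((γ t).below i).starProjection := by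
  rcases below_eq (ι := ι) i with h0 | ⟨j, -, hj⟩
  · have : (fun t => ((γ t).below i).starProjection) = fun _ => 0 := by
      funext t
      ext1 x
      rw [_root_.zero_apply, Submodule.starProjection_apply_eq_zero_iff, h0,
        Submodule.bot_orthogonal_eq_top]
      trivial
    rw [this]
    exact contDiff_const
  · have : (fun t => ((γ t).below i).starProjection) = fun t => (γ t).proj j := by
      funext t
      simp only [hj, proj]
    rw [this]
    exact contDiff_pi.mp h j

theorem sub_mem_line (V : KFlag ι k) (i : Fin k) (x : EuclideanSpace ℝ ι) :
    (V.space i).starProjection x - (V.below i).starProjection x ∈ V.line i := by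
  refine Submodule.mem_inf.mpr ⟨?_, ?_⟩
  · exact Submodule.sub_mem _ (Submodule.starProjection_apply_mem _ _)
      (V.below_le i (Submodule.starProjection_apply_mem _ _))
  · have h1 := Submodule.sub_starProjection_mem_orthogonal (K := V.below i) x
    have h2 := Submodule.orthogonal_le (V.below_le i)
      (Submodule.sub_starProjection_mem_orthogonal (K := V.space i) x)
    have := Submodule.sub_mem _ h1 h2
    simpa using this

/-- Project the fixed vector `e i` to the moving line `V_i ⊖ V_{i-1}` and normalize. The projection
is a smooth function of `t` with value `e i` at `0`, hence non-zero for small `t`. -/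
theorem exists_frame_of_curve {γ : ℝ → KFlag ι k} {e : Fin k → EuclideanSpace ℝ ι}
    (h : ContDiff ℝ ∞ fun t => (γ t).proj) (he : IsFrame e (γ 0)) :
    ∃ X : ℝ → Fin k → EuclideanSpace ℝ ι, ContDiffAt ℝ ∞ X 0 ∧ X 0 = e ∧
      ∀ᶠ t in 𝓝 0, IsFrame (X t) (γ t) := by
  let y : Fin k → ℝ → EuclideanSpace ℝ ι := fun i t =>
    ((γ t).space i).starProjection (e i) - ((γ t).below i).starProjection (e i)
  have hy : ∀ i, ContDiff ℝ ∞ (y i) := fun i =>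
    (contDiff_clm_apply_const (contDiff_pi.mp h i) (e i)).sub
      (contDiff_clm_apply_const (contDiff_below h i) (e i))
  have hy0 : ∀ i, y i 0 = e i := by
    intro i
    have h1 := (Submodule.starProjection_eq_self_iff (K := (γ 0).space i)).mpr (he.mem_line i).1
    have h2 := (Submodule.starProjection_apply_eq_zero_iff (K := (γ 0).below i)).mpr
      (he.mem_line i).2
    simp only [y, h1, h2, sub_zero]
  have hne : ∀ i, y i 0 ≠ 0 := fun i => by rw [hy0]; exact he.1.ne_zero i
  refine ⟨fun t i => ‖y i t‖⁻¹ • y i t, ?_, ?_, ?_⟩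
  · refine contDiffAt_pi.mpr fun i => ?_
    have h1 : ContDiffAt ℝ ∞ (fun t => ‖y i t‖) 0 := (hy i).contDiffAt.norm ℝ (hne i)
    exact (h1.inv (norm_ne_zero_iff.mpr (hne i))).smul (hy i).contDiffAt
  · funext i
    simp only [hy0, he.1.1 i, inv_one, one_smul]
  · have : ∀ᶠ t in 𝓝 (0 : ℝ), ∀ i, y i t ≠ 0 := by
      rw [eventually_all]
      exact fun i => (hy i).continuous.continuousAt.eventually_ne (hne i)
    filter_upwards [this] with t ht
    refine isFrame_of_mem_line (fun i => Submodule.smul_mem _ _ (sub_mem_line _ _ _)) fun i => ?_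
    rw [norm_smul, norm_inv, norm_norm, inv_mul_cancel₀ (norm_ne_zero_iff.mpr (ht i))]

section SecondDerivative

variable {E : Type*} [NormedAddCommGroup E] [InnerProductSpace ℝ E]

/-- The first two derivatives of a quadratic form along a curve in the unit sphere through an
eigenvector. -/
theorem quadratic_along_curve (D : E →L[ℝ] E) (hD : ∀ x y, inner ℝ (D x) y = inner ℝ x (D y))
    {X : ℝ → E} {Y : E} {μ : ℝ} (hX : ContDiffAt ℝ ∞ X 0) (hY : HasDerivAt X Y 0)
    (hn : ∀ᶠ t in 𝓝 0, ‖X t‖ = 1) (hμ : D (X 0) = μ • X 0) :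
    ContDiffAt ℝ 2 (fun t => (inner ℝ (D (X t)) (X t) : ℝ)) 0 ∧
      HasDerivAt (fun t => (inner ℝ (D (X t)) (X t) : ℝ)) 0 0 ∧
      iteratedDeriv 2 (fun t => (inner ℝ (D (X t)) (X t) : ℝ)) 0 =
        2 * (inner ℝ (D Y) Y - μ * inner ℝ Y Y) := by
  -- On the unit sphere, replacing `D` by `D - μ` changes the quadratic form only by the constant
  -- `μ`, and it makes the operator vanish at `X 0`.
  let D' : E →L[ℝ] E := D - μ • ContinuousLinearMap.id ℝ E
  have hD'a : ∀ x, D' x = D x - μ • x := fun x => by simp [D']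
  have hD' : ∀ x y, inner ℝ (D' x) y = inner ℝ x (D' y) := fun x y => by
    rw [hD'a, hD'a, inner_sub_left, inner_sub_right, hD, real_inner_smul_left,
      real_inner_smul_right]
  have h0 : D' (X 0) = 0 := by rw [hD'a, hμ, sub_self]
  have hev : (fun t => (inner ℝ (D (X t)) (X t) : ℝ)) =ᶠ[𝓝 0]
      fun t => μ + inner ℝ (D' (X t)) (X t) := by
    filter_upwards [hn] with t ht
    rw [hD'a, inner_sub_left, real_inner_smul_left, real_inner_self_eq_norm_sq, ht]
    ring
  have hX2 : ContDiffAt ℝ 2 X 0 := by exact_mod_cast contDiffAt_infty.mp hX 2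
  have hC : ContDiffAt ℝ 2 (fun t => (inner ℝ (D (X t)) (X t) : ℝ)) 0 :=
    (D.contDiff.contDiffAt.comp (0 : ℝ) hX2).inner ℝ hX2
  have hdX : ∀ᶠ t in 𝓝 (0 : ℝ), HasDerivAt X (deriv X t) t := by
    have h1 : ContDiffAt ℝ 1 X 0 := hX.of_le (by exact_mod_cast (le_top : (1 : ℕ∞) ≤ ⊤))
    filter_upwards [h1.eventually (by simp)] with t ht
    exact (ht.differentiableAt (by simp)).hasDerivAt
  have hder : ∀ᶠ t in 𝓝 (0 : ℝ), HasDerivAt (fun t => (inner ℝ (D (X t)) (X t) : ℝ))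
      (2 * inner ℝ (D' (X t)) (deriv X t)) t := by
    filter_upwards [hdX, hev.eventually_nhds] with t ht he
    have h1 : HasDerivAt (fun t => μ + (inner ℝ (D' (X t)) (X t) : ℝ))
        (inner ℝ (D' (X t)) (deriv X t) + inner ℝ (D' (deriv X t)) (X t)) t :=
      ((D'.hasFDerivAt.comp_hasDerivAt t ht).inner ℝ ht).const_add μ
    have h2 := h1.congr_of_eventuallyEq he
    rw [hD' (deriv X t), real_inner_comm _ (deriv X t), ← two_mul] at h2
    exact h2
  have hd : deriv (fun t => (inner ℝ (D (X t)) (X t) : ℝ)) =ᶠ[𝓝 0]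
      fun t => 2 * inner ℝ (D' (X t)) (deriv X t) := by
    filter_upwards [hder] with t ht using ht.deriv
  refine ⟨hC, ?_, ?_⟩
  · have := hder.self_of_nhds
    rwa [h0, inner_zero_left, mul_zero] at this
  · have hdd : DifferentiableAt ℝ (deriv X) 0 := by
      have := (contDiffAt_succ_iff_hasFDerivAt (n := 1)).mp
        (by simpa [one_add_one_eq_two] using hX2)
      obtain ⟨f', ⟨v, hv, hf⟩, hf'⟩ := this
      have : deriv X =ᶠ[𝓝 0] fun t => f' t 1 := by
        filter_upwards [hv] with t ht
        exact (hf t ht).hasDerivAt.deriv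
      exact ((hf'.differentiableAt (by simp)).clm_apply
        (differentiableAt_const 1)).congr_of_eventuallyEq this
    rw [iteratedDeriv_succ, iteratedDeriv_one, hd.deriv_eq]
    have h1 := ((D'.hasFDerivAt.comp_hasDerivAt 0 hY).inner ℝ hdd.hasDerivAt).const_mul 2
    have h2 := h1.deriv
    simp only [Function.comp_apply] at h2
    -- The acceleration is paired with `D' (X 0) = 0` and drops out.
    rw [h2, h0, inner_zero_left, zero_add, hY.deriv, hD'a, inner_sub_left, real_inner_smul_left]

end SecondDerivative

/-! ## Infinitesimal frames -/

/-- The derivatives of curves of orthonormal frames. -/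
def skewSpace (e : Fin k → EuclideanSpace ℝ ι) : Submodule ℝ (Fin k → EuclideanSpace ℝ ι) where
  carrier := {Y | ∀ i j, (inner ℝ (Y i) (e j) + inner ℝ (e i) (Y j) : ℝ) = 0}
  zero_mem' i j := by simp
  add_mem' {Y Z} hY hZ i j := by
    have h1 := hY i j
    have h2 := hZ i j
    simp only [Pi.add_apply, inner_add_left, inner_add_right]
    linarith
  smul_mem' c Y hY i j := by
    have h1 := hY i j
    simp only [Pi.smul_apply, real_inner_smul_left, real_inner_smul_right]
    rw [← mul_add, h1, mul_zero]

/-- The inverse of `vel` on `skewSpace`. -/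
def unvel (e : Fin k → EuclideanSpace ℝ ι) :
    (Fin k → (EuclideanSpace ℝ ι →L[ℝ] EuclideanSpace ℝ ι)) →ₗ[ℝ]
      (Fin k → EuclideanSpace ℝ ι) where
  toFun w := fun i => w i (e i) - ∑ s ∈ Finset.Iio i, (inner ℝ (e i) (w s (e s)) : ℝ) • e s
  map_add' w w' := by
    funext i
    simp only [Pi.add_apply, _root_.add_apply, inner_add_right, add_smul,
      Finset.sum_add_distrib]
    abel
  map_smul' c w := by
    funext i
    simp only [Pi.smul_apply, _root_.smul_apply, real_inner_smul_right, mul_smul,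
      RingHom.id_apply, smul_sub, Finset.smul_sum]

/-- Evaluating `vel e Y i` at `e i` gives `Y i` plus the terms `⟨Y s, e i⟩ e s` with `s ≤ i`. For `s
< i` the coefficient can be read off from `vel e Y s` at `e s`, and for `s = i` it vanishes by
skewness. -/
theorem unvel_vel {e Y : Fin k → EuclideanSpace ℝ ι} (he : Orthonormal ℝ e)
    (hY : Y ∈ skewSpace e) : unvel e (vel e Y) = Y := by
  have hsk : ∀ i j, (inner ℝ (Y i) (e j) + inner ℝ (e i) (Y j) : ℝ) = 0 := hY
  have hee : ∀ i, (inner ℝ (e i) (e i) : ℝ) = 1 := fun i => by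
    rw [real_inner_self_eq_norm_sq, he.1 i, one_pow]
  have h1 : ∀ i, vel e Y i (e i) = Y i + ∑ s ∈ Finset.Iic i, (inner ℝ (Y s) (e i) : ℝ) • e s := by
    intro i
    simp only [vel_apply, _root_.sum_apply, _root_.add_apply, rk_apply, Finset.sum_add_distrib]
    rw [add_comm]
    congr 1
    rw [Finset.sum_eq_single i, hee, one_smul]
    · intro s _ hs
      rw [he.2 hs, zero_smul]
    · intro h
      exact absurd (Finset.mem_Iic.mpr le_rfl) h
  have h2 : ∀ i, ∀ s ∈ Finset.Iio i, (inner ℝ (e i) (vel e Y s (e s)) : ℝ) =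
      inner ℝ (Y s) (e i) := by
    intro i s hs
    rw [h1, inner_add_right, inner_sum, Finset.sum_eq_zero, add_zero, real_inner_comm]
    intro r hr
    have : i ≠ r := ((Finset.mem_Iic.mp hr).trans_lt (Finset.mem_Iio.mp hs)).ne'
    rw [real_inner_smul_right, he.2 this, mul_zero]
  have h3 : ∀ i, (inner ℝ (Y i) (e i) : ℝ) = 0 := fun i => by
    have := hsk i i
    rw [real_inner_comm (Y i) (e i)] at this
    linarith
  funext i
  change vel e Y i (e i) - ∑ s ∈ Finset.Iio i, (inner ℝ (e i) (vel e Y s (e s)) : ℝ) • e s = Y i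
  rw [Finset.sum_congr rfl fun s hs => by rw [h2 i s hs], h1,
    ← Finset.Iio_insert, Finset.sum_insert (by simp), h3, zero_smul, zero_add, add_sub_cancel_right]

/-- A smooth curve of flags is described by a smooth curve of frames. -/
theorem IsSmoothCurve.exists_frame {S : Set (KFlag ι k)} {V : KFlag ι k} {γ : ℝ → KFlag ι k}
    (h : IsSmoothCurve S V γ) {e : Fin k → EuclideanSpace ℝ ι} (he : IsFrame e V) :
    ∃ (X : ℝ → Fin k → EuclideanSpace ℝ ι) (Y : Fin k → EuclideanSpace ℝ ι),
      ContDiffAt ℝ ∞ X 0 ∧ X 0 = e ∧ (∀ᶠ t in 𝓝 0, IsFrame (X t) (γ t)) ∧ HasDerivAt X Y 0 ∧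
      HasDerivAt (fun t => (γ t).proj) (vel e Y) 0 := by
  obtain ⟨X, hX, hX0, hXf⟩ := exists_frame_of_curve h.2.2 (h.1.symm ▸ he)
  have hd : HasDerivAt X (deriv X 0) 0 := (hX.differentiableAt (by simp)).hasDerivAt
  refine ⟨X, deriv X 0, hX, hX0, hXf, hd, ?_⟩
  have := hasDerivAt_frameProj hd
  rw [hX0] at this
  refine this.congr_of_eventuallyEq ?_
  filter_upwards [hXf] with t ht using ht.proj_eq

/-- Differentiate the constant entries of the Gram matrix. -/
theorem mem_skewSpace_of_hasDerivAt {X : ℝ → Fin k → EuclideanSpace ℝ ι}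
    {Y : Fin k → EuclideanSpace ℝ ι} (hY : HasDerivAt X Y 0)
    (h : ∀ᶠ t in 𝓝 0, Orthonormal ℝ (X t)) : Y ∈ skewSpace (X 0) := by
  intro i j
  rw [hasDerivAt_pi] at hY
  have h1 := (hY i).inner ℝ (hY j)
  have h2 : (fun t => (inner ℝ (X t i) (X t j) : ℝ)) =ᶠ[𝓝 0] fun _ => if i = j then 1 else 0 := by
    filter_upwards [h] with t ht
    exact orthonormal_iff_ite.mp ht i j
  have h3 := (hasDerivAt_const (0 : ℝ) (if i = j then (1 : ℝ) else 0)).congr_of_eventuallyEq h2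
  rw [add_comm]
  exact h1.unique h3

theorem isSmoothCurve_ofFrame {S : Set (KFlag ι k)} {X : ℝ → Fin k → EuclideanSpace ℝ ι}
    (hX : ContDiff ℝ ∞ X) (ho : ∀ t, Orthonormal ℝ (X t)) (hS : ∀ t, ofFrame (X t) (ho t) ∈ S)
    {V : KFlag ι k} (hV : ofFrame (X 0) (ho 0) = V) :
    IsSmoothCurve S V fun t => ofFrame (X t) (ho t) := by
  refine ⟨hV, hS, ?_⟩
  simp only [fun t => (isFrame_ofFrame (X t) (ho t)).proj_eq]
  exact contDiff_frameProj hX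

theorem hasDerivAt_proj_ofFrame {X : ℝ → Fin k → EuclideanSpace ℝ ι}
    (ho : ∀ t, Orthonormal ℝ (X t)) {Y : Fin k → EuclideanSpace ℝ ι} (hY : HasDerivAt X Y 0) :
    HasDerivAt (fun t => (ofFrame (X t) (ho t)).proj) (vel (X 0) Y) 0 := by
  simp only [fun t => (isFrame_ofFrame (X t) (ho t)).proj_eq]
  exact hasDerivAt_frameProj hY

/-! ## One-parameter groups of rotations -/

section Exp

variable {E : Type*} [NormedAddCommGroup E] [InnerProductSpace ℝ E] [CompleteSpace E]

theorem inner_exp_of_skew {Z : E →L[ℝ] E}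
    (hZ : ∀ x y, (inner ℝ (Z x) y : ℝ) = -inner ℝ x (Z y)) (t : ℝ) (x y : E) :
    (inner ℝ (NormedSpace.exp (t • Z) x) (NormedSpace.exp (t • Z) y) : ℝ) = inner ℝ x y := by
  have hs : t • Z ∈ skewAdjoint (E →L[ℝ] E) := by
    rw [skewAdjoint.mem_iff, ContinuousLinearMap.star_eq_adjoint, eq_comm,
      ContinuousLinearMap.eq_adjoint_iff]
    intro x y
    simp [real_inner_smul_left, real_inner_smul_right, hZ]
  let _ := NormedAlgebra.restrictScalars ℚ ℝ (E →L[ℝ] E)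
  have hu := NormedSpace.exp_mem_unitary_of_mem_skewAdjoint hs
  exact ContinuousLinearMap.inner_map_map_of_mem_unitary hu x y

theorem contDiff_exp_apply (Z : E →L[ℝ] E)
    (v : E) : ContDiff ℝ ∞ fun t : ℝ => NormedSpace.exp (t • Z) v := by
  refine contDiff_clm_apply_const ?_ v
  have h : ContDiff ℝ ∞ (NormedSpace.exp : (E →L[ℝ] E) → _) := by
    rw [contDiff_iff_contDiffAt]
    exact fun x => (NormedSpace.exp_analytic (𝕂 := ℝ) x).contDiffAt
  exact h.comp (contDiff_id.smul contDiff_const)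

theorem hasDerivAt_exp_apply (Z : E →L[ℝ] E)
    (v : E) : HasDerivAt (fun t : ℝ => NormedSpace.exp (t • Z) v) (Z v) 0 := by
  have h := (hasDerivAt_exp_smul_const (𝕂 := ℝ) Z 0).clm_apply (hasDerivAt_const (0 : ℝ) v)
  have h0 : NormedSpace.exp ((0 : ℝ) • Z) = 1 := by rw [zero_smul, NormedSpace.exp_zero]
  simpa [h0] using h

end Exp

theorem exp_zero_smul_apply {E : Type*} [NormedAddCommGroup E] [InnerProductSpace ℝ E]
    (Z : E →L[ℝ] E) (v : E) : NormedSpace.exp ((0 : ℝ) • Z) v = v := by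
  rw [zero_smul, NormedSpace.exp_zero, one_apply_eq_self]

/-! ## The second variation -/

/-- The Hessian of `quadFun M b` at the flag of a frame of eigenvectors of `M` with eigenvalues
`μ`, as a bilinear form in the derivative of a frame. -/
def hform [DecidableEq ι] (M : Matrix ι ι ℝ) (b μ : Fin k → ℝ) :
    LinearMap.BilinForm ℝ (Fin k → EuclideanSpace ℝ ι) :=
  LinearMap.mk₂ ℝ (fun Y Z => (k : ℝ)⁻¹ * ∑ i, b i ^ 2 *
      (2 * (inner ℝ (M.toEuclideanLin (Y i)) (Z i) - μ i * inner ℝ (Y i) (Z i))))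
    (fun Y Y' Z => by
      rw [← mul_add, ← Finset.sum_add_distrib]
      congr 1
      refine Finset.sum_congr rfl fun i _ => ?_
      rw [Pi.add_apply, map_add, inner_add_left, inner_add_left]
      ring)
    (fun c Y Z => by
      simp only [smul_eq_mul, Finset.mul_sum]
      refine Finset.sum_congr rfl fun i _ => ?_
      rw [Pi.smul_apply, map_smul, real_inner_smul_left, real_inner_smul_left]
      ring)
    (fun Y Z Z' => by
      rw [← mul_add, ← Finset.sum_add_distrib]
      congr 1
      refine Finset.sum_congr rfl fun i _ => ?_
      rw [Pi.add_apply, inner_add_right, inner_add_right]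
      ring)
    (fun c Y Z => by
      simp only [smul_eq_mul, Finset.mul_sum]
      refine Finset.sum_congr rfl fun i _ => ?_
      rw [Pi.smul_apply, real_inner_smul_right, real_inner_smul_right]
      ring)

theorem hform_apply [DecidableEq ι] (M : Matrix ι ι ℝ) (b μ : Fin k → ℝ)
    (Y Z : Fin k → EuclideanSpace ℝ ι) :
    hform M b μ Y Z = (k : ℝ)⁻¹ * ∑ i, b i ^ 2 *
      (2 * (inner ℝ (M.toEuclideanLin (Y i)) (Z i) - μ i * inner ℝ (Y i) (Z i))) := rfl

theorem hform_comm [DecidableEq ι] {M : Matrix ι ι ℝ} (b μ : Fin k → ℝ)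
    (hM : ∀ x y, (inner ℝ (M.toEuclideanLin x) y : ℝ) = inner ℝ x (M.toEuclideanLin y))
    (Y Z : Fin k → EuclideanSpace ℝ ι) : hform M b μ Y Z = hform M b μ Z Y := by
  simp only [hform_apply]
  congr 1
  refine Finset.sum_congr rfl fun i _ => ?_
  rw [hM, real_inner_comm, real_inner_comm (Z i)]

/-- A component in an eigenspace is paired with the coordinate in its direction. -/
theorem hform_single [DecidableEq ι] {M : Matrix ι ι ℝ} (b μ : Fin k → ℝ) {i : Fin k}
    {f : EuclideanSpace ℝ ι} {c : ℝ} (hf : M.toEuclideanLin f = c • f)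
    (Z : Fin k → EuclideanSpace ℝ ι) :
    hform M b μ (Pi.single i f) Z = 2 * (k : ℝ)⁻¹ * b i ^ 2 * (c - μ i) * inner ℝ f (Z i) := by
  rw [hform_apply, Finset.sum_eq_single i]
  · rw [Pi.single_eq_same, hf, real_inner_smul_left]
    ring
  · intro s _ hs
    rw [Pi.single_eq_of_ne hs, map_zero, inner_zero_left]
    ring
  · intro h
    exact absurd (Finset.mem_univ i) h

/-- The weighted sum of `quadratic_along_curve` over the columns; the second derivative sees the
curve only through `Y`, which makes it a quadratic form on velocities. -/
theorem quadFun_along_frame [DecidableEq ι] {M : Matrix ι ι ℝ} {b μ : Fin k → ℝ}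
    (hb : ∀ i, 0 < b i)
    (hM : ∀ x y, (inner ℝ (M.toEuclideanLin x) y : ℝ) = inner ℝ x (M.toEuclideanLin y))
    {γ : ℝ → KFlag ι k} {X : ℝ → Fin k → EuclideanSpace ℝ ι} {Y : Fin k → EuclideanSpace ℝ ι}
    (hX : ContDiffAt ℝ ∞ X 0) (hf : ∀ᶠ t in 𝓝 0, IsFrame (X t) (γ t)) (hY : HasDerivAt X Y 0)
    (hμ : ∀ i, M.toEuclideanLin (X 0 i) = μ i • X 0 i) :
    ContDiffAt ℝ 2 (fun t => quadFun M b (γ t)) 0 ∧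
      HasDerivAt (fun t => quadFun M b (γ t)) 0 0 ∧
      iteratedDeriv 2 (fun t => quadFun M b (γ t)) 0 = hform M b μ Y Y := by
  let D : EuclideanSpace ℝ ι →L[ℝ] EuclideanSpace ℝ ι := M.toEuclideanLin.toContinuousLinearMap
  have hq := fun i => quadratic_along_curve D hM (contDiffAt_pi.mp hX i) (hasDerivAt_pi.mp hY i)
    (hf.mono fun t ht => ht.1.1 i) (hμ i)
  have hev : (fun t => quadFun M b (γ t)) =ᶠ[𝓝 0] fun t =>
      (k : ℝ)⁻¹ * ∑ i, b i ^ 2 * (inner ℝ (D (X t i)) (X t i) : ℝ) := by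
    filter_upwards [hf] with t ht using quadFun_eq_of_isFrame M hb ht
  have hc : ∀ i ∈ (Finset.univ : Finset (Fin k)), ContDiffAt ℝ 2
      (fun t => b i ^ 2 * (inner ℝ (D (X t i)) (X t i) : ℝ)) 0 :=
    fun i _ => contDiffAt_const.mul (hq i).1
  refine ⟨(contDiffAt_const.mul (ContDiffAt.sum hc)).congr_of_eventuallyEq hev, ?_, ?_⟩
  · have := (HasDerivAt.fun_sum (u := Finset.univ) fun i _ =>
      (hq i).2.1.const_mul (b i ^ 2)).const_mul (k : ℝ)⁻¹
    simp only [mul_zero, Finset.sum_const_zero] at this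
    exact this.congr_of_eventuallyEq hev
  · rw [hev.iteratedDeriv_eq 2, iteratedDeriv_const_mul_field, iteratedDeriv_fun_sum hc,
      hform_apply]
    congr 1
    refine Finset.sum_congr rfl fun i _ => ?_
    rw [iteratedDeriv_const_mul_field, (hq i).2.2]
    rfl

/-! ## Systems of one-dimensional strata -/

/-- The derivatives at `V_π` of the curves of frames in a manifold `S` of flags, with coordinates
dual to the velocities of a family of curves in one-dimensional strata. -/
structure StratumSystem (Λ : Type) [DecidableEq Λ]
    (u : OrthonormalBasis ι ℝ (EuclideanSpace ℝ ι)) (π : Fin k ↪ ι) (S : Set (KFlag ι k))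
    (str : Λ → Set (KFlag ι k)) (F : Λ → ℝ → Fin k → EuclideanSpace ℝ ι) where
  K : Submodule ℝ (Fin k → EuclideanSpace ℝ ι)
  K_le : K ≤ skewSpace fun i => u (π i)
  -- This field and the next identify `K` with the set of all derivatives of frames along curves in
  -- `S`. The curves in `exists_curve` are global because `IsSmoothCurve` asks for smoothness on all
  -- of `ℝ`.
  mem_K : ∀ (γ : ℝ → KFlag ι k) (X : ℝ → Fin k → EuclideanSpace ℝ ι) (Y), (∀ t, γ t ∈ S) →
    (X 0 = fun i => u (π i)) → (∀ᶠ t in 𝓝 0, IsFrame (X t) (γ t)) → HasDerivAt X Y 0 → Y ∈ K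
  exists_curve : ∀ Y ∈ K, ∃ (X : ℝ → Fin k → EuclideanSpace ℝ ι) (ho : ∀ t, Orthonormal ℝ (X t)),
    ContDiff ℝ ∞ X ∧ (∀ t, ofFrame (X t) (ho t) ∈ S) ∧ (X 0 = fun i => u (π i)) ∧
      HasDerivAt X Y 0
  coord : (Fin k → EuclideanSpace ℝ ι) →ₗ[ℝ] (Λ → ℝ)
  coord_inj : ∀ Y ∈ K, coord Y = 0 → Y = 0
  sets : Λ → Fin k → Set ι
  str_subset : ∀ x, str x ⊆ S
  str_subset_stratum : ∀ x, str x ⊆ stratum u (sets x)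
  -- A derivative supported in the index sets of the circle `x` has no coordinate at another circle.
  -- This yields both the duality of `coord` and `dir` and the rigidity of eigenvector bases.
  coord_eq_zero : ∀ x z, z ≠ x → ∀ Y : Fin k → EuclideanSpace ℝ ι,
    (∀ i, ∀ a ∉ sets x i, inner ℝ (u a) (Y i) = (0 : ℝ)) → coord Y z = 0
  smooth : ∀ x, ContDiff ℝ ∞ (F x)
  orthonormal : ∀ x t, Orthonormal ℝ (F x t)
  mem_str : ∀ x t, ofFrame (F x t) (orthonormal x t) ∈ str x
  frame_zero : ∀ x, F x 0 = fun i => u (π i)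
  dir : Λ → Fin k → EuclideanSpace ℝ ι
  hasDerivAt : ∀ x, HasDerivAt (F x) (dir x) 0
  coord_dir_self : ∀ x, coord (dir x) x = 1

namespace StratumSystem

variable {Λ : Type} [DecidableEq Λ] {u : OrthonormalBasis ι ℝ (EuclideanSpace ℝ ι)}
  {π : Fin k ↪ ι} {S : Set (KFlag ι k)} {str : Λ → Set (KFlag ι k)}
  {F : Λ → ℝ → Fin k → EuclideanSpace ℝ ι} (L : StratumSystem Λ u π S str F)

theorem dir_mem (x : Λ) : L.dir x ∈ L.K :=
  L.mem_K (fun t => ofFrame (F x t) (L.orthonormal x t)) (F x) _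
    (fun t => L.str_subset x (L.mem_str x t)) (L.frame_zero x)
    (Eventually.of_forall fun _ => isFrame_ofFrame _ _) (L.hasDerivAt x)

theorem isFrame_coordFlag : IsFrame (fun i => u (π i)) (coordFlag u π) :=
  isFrame_ofFrame _ _

theorem exists_velocity {γ : ℝ → KFlag ι k} (h : IsSmoothCurve S (coordFlag u π) γ) :
    ∃ X, ∃ Y ∈ L.K, ContDiffAt ℝ ∞ X 0 ∧ (X 0 = fun i => u (π i)) ∧
      (∀ᶠ t in 𝓝 0, IsFrame (X t) (γ t)) ∧ HasDerivAt X Y 0 ∧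
      HasDerivAt (fun t => (γ t).proj) (vel (fun i => u (π i)) Y) 0 := by
  obtain ⟨X, Y, hX, hX0, hXf, hd, hv⟩ := h.exists_frame isFrame_coordFlag
  exact ⟨X, Y, L.mem_K γ X Y h.2.1 hX0 hXf hd, hX, hX0, hXf, hd, hv⟩

theorem unvel_vel {Y : Fin k → EuclideanSpace ℝ ι} (hY : Y ∈ L.K) :
    unvel (fun i => u (π i)) (vel (fun i => u (π i)) Y) = Y :=
  KFlag.unvel_vel (isFrame_coordFlag (u := u) (π := π)).1 (L.K_le hY)

theorem exists_smoothCurve {Y : Fin k → EuclideanSpace ℝ ι} (hY : Y ∈ L.K) :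
    ∃ γ, IsSmoothCurve S (coordFlag u π) γ ∧
      HasDerivAt (fun t => (γ t).proj) (vel (fun i => u (π i)) Y) 0 := by
  obtain ⟨X, ho, hX, hS, hX0, hd⟩ := L.exists_curve Y hY
  refine ⟨fun t => ofFrame (X t) (ho t), isSmoothCurve_ofFrame hX ho hS ?_, ?_⟩
  · simp only [hX0, coordFlag]
  · have := hasDerivAt_proj_ofFrame ho hd
    rwa [hX0] at this

/-- The velocities already form a linear space, because every element of the subspace `K` is
realized by a curve; taking the span adds nothing. -/
theorem tangentSpace_eq :
    tangentSpace S (coordFlag u π) = L.K.map (vel fun i => u (π i)) := by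
  refine le_antisymm (Submodule.span_le.mpr ?_) ?_
  · rintro w ⟨γ, hγ, hw⟩
    obtain ⟨X, Y, hY, -, -, -, -, hv⟩ := L.exists_velocity hγ
    exact ⟨Y, hY, hv.unique hw⟩
  · rintro _ ⟨Y, hY, rfl⟩
    exact Submodule.subset_span (L.exists_smoothCurve hY)

theorem unvel_mem {w} (hw : w ∈ tangentSpace S (coordFlag u π)) :
    unvel (fun i => u (π i)) w ∈ L.K ∧
      vel (fun i => u (π i)) (unvel (fun i => u (π i)) w) = w := by
  rw [L.tangentSpace_eq] at hw
  obtain ⟨Y, hY, rfl⟩ := hw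
  rw [L.unvel_vel hY]
  exact ⟨hY, rfl⟩

/-- The derivative of a curve of frames with a given velocity. -/
def lift : tangentSpace S (coordFlag u π) →ₗ[ℝ] (Fin k → EuclideanSpace ℝ ι) :=
  (unvel fun i => u (π i)) ∘ₗ (tangentSpace S (coordFlag u π)).subtype

theorem lift_apply (w : tangentSpace S (coordFlag u π)) :
    lift w = unvel (fun i => u (π i)) w.1 := rfl

theorem lift_mem (w : tangentSpace S (coordFlag u π)) : lift w ∈ L.K := (L.unvel_mem w.2).1

theorem vel_lift (L : StratumSystem Λ u π S str F)
    (w : tangentSpace S (coordFlag u π)) :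
    vel (fun i => u (π i)) (lift w) = w.1 := (L.unvel_mem w.2).2

/-- The velocities of the curves of the system. -/
def velocity (x : Λ) : tangentSpace S (coordFlag u π) :=
  ⟨vel (fun i => u (π i)) (L.dir x), by
    rw [L.tangentSpace_eq]
    exact ⟨_, L.dir_mem x, rfl⟩⟩

theorem lift_velocity (x : Λ) : lift (L.velocity x) = L.dir x := L.unvel_vel (L.dir_mem x)

theorem velocity_mem (x : Λ) : (L.velocity x).1 ∈ tangentSpace (str x) (coordFlag u π) := by
  refine Submodule.subset_span ⟨fun t => ofFrame (F x t) (L.orthonormal x t),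
    isSmoothCurve_ofFrame (L.smooth x) _ (L.mem_str x) ?_, ?_⟩
  · simp only [L.frame_zero, coordFlag]
  · have := hasDerivAt_proj_ofFrame (L.orthonormal x) (L.hasDerivAt x)
    rwa [L.frame_zero] at this

/-- Along a curve in the stratum, the components of the frame outside the prescribed spans vanish
identically near `0`, hence so do those of its derivative. Linearity extends this from velocities to
their span. -/
theorem coord_eq_zero_of_mem {x z : Λ} (hxz : z ≠ x) {w : tangentSpace S (coordFlag u π)}
    (hw : w.1 ∈ tangentSpace (str x) (coordFlag u π)) : L.coord (lift w) z = 0 := by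
  rw [lift_apply]
  generalize w.1 = w' at hw
  induction hw using Submodule.span_induction with
  | mem w' h =>
    obtain ⟨γ, hγ, hw'⟩ := h
    obtain ⟨X, Y, hY, -, hX0, hXf, hd, hv⟩ := L.exists_velocity
      (⟨hγ.1, fun t => L.str_subset x (hγ.2.1 t), hγ.2.2⟩ : IsSmoothCurve S _ γ)
    rw [hw'.unique hv, L.unvel_vel hY]
    refine L.coord_eq_zero x z hxz Y fun i a ha => ?_
    have h1 := (hasDerivAt_const (0 : ℝ) (u a)).inner ℝ (hasDerivAt_pi.mp hd i)
    have h2 : (fun t => (inner ℝ (u a) (X t i) : ℝ)) =ᶠ[𝓝 0] fun _ => 0 := by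
      filter_upwards [hXf] with t ht
      exact inner_eq_zero_of_mem_span_image u
        (ht.mem_span_of_mem_stratum (L.str_subset_stratum x (hγ.2.1 t)) i) ha
    have h3 := h1.unique ((hasDerivAt_const (0 : ℝ) (0 : ℝ)).congr_of_eventuallyEq h2)
    simpa using h3
  | zero => simp
  | add w w' _ _ h h' => rw [map_add, map_add, Pi.add_apply, h, h', add_zero]
  | smul c w _ h => rw [map_smul, map_smul, Pi.smul_apply, h, smul_zero]

theorem coord_dir (x : Λ) : L.coord (L.dir x) = Pi.single x 1 := by
  funext z
  by_cases h : z = x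
  · subst h
    rw [L.coord_dir_self, Pi.single_eq_same]
  · rw [← L.lift_velocity, L.coord_eq_zero_of_mem h (L.velocity_mem x), Pi.single_eq_of_ne h]

theorem coord_lift_injective :
    Function.Injective (L.coord ∘ₗ (lift : tangentSpace S (coordFlag u π) →ₗ[ℝ] _)) := by
  refine (injective_iff_map_eq_zero _).mpr fun w hw => ?_
  have h0 : lift w = 0 := L.coord_inj _ (L.lift_mem w) hw
  have := L.vel_lift w
  rw [h0, map_zero] at this
  exact Subtype.ext this.symm

/-! ### Eigenvector bases -/

section Basis

variable [Fintype Λ]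

/-- Surjectivity of the coordinates. Together with `coord_lift_injective` it shows that the
dimension is the number of circles. -/
theorem coord_lift_sum (c : Λ → ℝ) : L.coord (lift (∑ x, c x • L.velocity x)) = c := by
  simp only [map_sum, map_smul, lift_velocity, L.coord_dir]
  funext z
  simp [Finset.sum_apply, Pi.single_apply]

/-- The coordinates of tangent vectors with respect to the velocities of the system. -/
def coordEquiv : tangentSpace S (coordFlag u π) ≃ₗ[ℝ] (Λ → ℝ) :=
  LinearEquiv.ofBijective (L.coord ∘ₗ lift)
    ⟨L.coord_lift_injective, fun c => ⟨_, L.coord_lift_sum c⟩⟩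

theorem coordEquiv_apply (w : tangentSpace S (coordFlag u π)) :
    L.coordEquiv w = L.coord (lift w) := rfl

/-- The basis of the tangent space formed by the velocities of the system. -/
def basis : Basis Λ ℝ (tangentSpace S (coordFlag u π)) := Basis.ofEquivFun L.coordEquiv

theorem basis_apply (x : Λ) : L.basis x = L.velocity x := by
  rw [basis, Basis.coe_ofEquivFun, LinearEquiv.symm_apply_eq, coordEquiv_apply, lift_velocity,
    L.coord_dir]

theorem finrank_tangentSpace (L : StratumSystem Λ u π S str F) :
    finrank ℝ (tangentSpace S (coordFlag u π)) = Nat.card Λ := by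
  rw [Module.finrank_eq_nat_card_basis L.basis]

theorem isEigenvectorBasis_basis : IsEigenvectorBasis S (coordFlag u π) str L.basis := by
  intro x
  rw [L.basis_apply]
  exact L.velocity_mem x

theorem exists_circles : ∃ c : Λ → ℝ → KFlag ι k,
    (∀ x t, IsFrame (F x t) (c x t)) ∧
      ∀ x, HasDerivAt (fun t => (c x t).proj) (L.basis x).1 0 := by
  refine ⟨fun x t => ofFrame (F x t) (L.orthonormal x t), fun x t => isFrame_ofFrame _ _,
    fun x => ?_⟩
  have := hasDerivAt_proj_ofFrame (L.orthonormal x) (L.hasDerivAt x)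
  rw [L.frame_zero] at this
  rwa [L.basis_apply]

theorem eq_smul_of_mem {x : Λ} {w : tangentSpace S (coordFlag u π)}
    (hw : w.1 ∈ tangentSpace (str x) (coordFlag u π)) :
    w = L.coord (lift w) x • L.basis x := by
  apply L.coordEquiv.injective
  rw [map_smul, L.basis_apply, coordEquiv_apply, coordEquiv_apply, lift_velocity, L.coord_dir]
  funext z
  by_cases h : z = x
  · subst h
    simp
  · rw [L.coord_eq_zero_of_mem h hw]
    simp [h]

theorem exists_smul_of_isEigenvectorBasis {v : Basis Λ ℝ (tangentSpace S (coordFlag u π))}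
    (hv : IsEigenvectorBasis S (coordFlag u π) str v) :
    ∃ r : Λ → ℝ, ∀ x, r x ≠ 0 ∧ v x = r x • L.basis x := by
  refine ⟨fun x => L.coord (lift (v x)) x, fun x => ⟨fun h => ?_, L.eq_smul_of_mem (hv x)⟩⟩
  have := L.eq_smul_of_mem (hv x)
  rw [show L.coord (lift (v x)) x = 0 from h, zero_smul] at this
  exact v.ne_zero x this

end Basis

/-! ### The Hessian -/

/-- A symmetric form is determined by its quadratic form, and every tangent vector is the velocity
of a curve, so that the second derivatives determine the form. -/
theorem eq_of_isHessianAt (L : StratumSystem Λ u π S str F)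
    {f : KFlag ι k → ℝ}
    {B B' : LinearMap.BilinForm ℝ (tangentSpace S (coordFlag u π))}
    (h : IsHessianAt S f (coordFlag u π) B) (h' : IsHessianAt S f (coordFlag u π) B') :
    B' = B := by
  refine LinearMap.BilinForm.ext_of_isSymm h'.1 h.1 fun w => ?_
  obtain ⟨γ, hγ, hw⟩ := L.exists_smoothCurve (L.lift_mem w)
  rw [L.vel_lift] at hw
  rw [← (h'.2 γ hγ w hw).2, (h.2 γ hγ w hw).2]

variable [DecidableEq ι] (M : Matrix ι ι ℝ) (b μ : Fin k → ℝ)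

/-- The Hessian of `quadFun M b`. -/
def hessian : LinearMap.BilinForm ℝ (tangentSpace S (coordFlag u π)) :=
  (hform M b μ).comp lift lift

theorem hessian_apply (v w : tangentSpace S (coordFlag u π)) :
    hessian M b μ v w = hform M b μ (lift v) (lift w) := rfl

variable {M b μ}

theorem isCriticalAt (L : StratumSystem Λ u π S str F)
    (hb : ∀ i, 0 < b i)
    (hM : ∀ x y, (inner ℝ (M.toEuclideanLin x) y : ℝ) = inner ℝ x (M.toEuclideanLin y))
    (hμ : ∀ i, M.toEuclideanLin (u (π i)) = μ i • u (π i)) :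
    IsCriticalAt S (quadFun M b) (coordFlag u π) := by
  intro γ hγ
  obtain ⟨X, Y, hY, hX, hX0, hXf, hd, hv⟩ := L.exists_velocity hγ
  exact (quadFun_along_frame (μ := μ) hb hM hX hXf hd fun i => by rw [hX0, hμ]).2.1

theorem isHessianAt (L : StratumSystem Λ u π S str F)
    (hb : ∀ i, 0 < b i)
    (hM : ∀ x y, (inner ℝ (M.toEuclideanLin x) y : ℝ) = inner ℝ x (M.toEuclideanLin y))
    (hμ : ∀ i, M.toEuclideanLin (u (π i)) = μ i • u (π i)) :
    IsHessianAt S (quadFun M b) (coordFlag u π) (hessian M b μ) := by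
  refine ⟨⟨fun v w => hform_comm b μ hM _ _⟩, fun γ hγ w hw => ?_⟩
  obtain ⟨X, Y, hY, hX, hX0, hXf, hd, hv⟩ := L.exists_velocity hγ
  have h := quadFun_along_frame (μ := μ) hb hM hX hXf hd fun i => by rw [hX0, hμ]
  refine ⟨h.1, ?_⟩
  rw [h.2.2, hessian_apply, lift_apply, hw.unique hv, L.unvel_vel hY]

variable [Fintype Λ]

/-- The hypothesis `hval` is an eigenvector equation: pairing with `dir x` is `val x` times the dual
coordinate. Duality then gives the diagonal matrix. -/
theorem hessian_basis {val : Λ → ℝ}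
    (hval : ∀ x, ∀ Y ∈ L.K, hform M b μ (L.dir x) Y = val x * L.coord Y x) (x z : Λ) :
    hessian M b μ (L.basis x) (L.basis z) = if x = z then val x else 0 := by
  rw [hessian_apply, L.basis_apply, L.basis_apply, L.lift_velocity, L.lift_velocity,
    hval x _ (L.dir_mem z), L.coord_dir, Pi.single_apply]
  split_ifs <;> simp

/-- Every eigenvector basis diagonalizes the Hessian. -/
theorem hessian_diagonal {val : Λ → ℝ}
    (hval : ∀ x, ∀ Y ∈ L.K, hform M b μ (L.dir x) Y = val x * L.coord Y x)
    {v : Basis Λ ℝ (tangentSpace S (coordFlag u π))}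
    (hv : IsEigenvectorBasis S (coordFlag u π) str v) :
    (∀ x y, x ≠ y → hessian M b μ (v x) (v y) = 0) ∧
      ∀ x, ∃ r : ℝ, r ≠ 0 ∧ v x = r • L.basis x ∧
        hessian M b μ (v x) (v x) = r ^ 2 * val x := by
  obtain ⟨r, hr⟩ := L.exists_smul_of_isEigenvectorBasis hv
  have h : ∀ x y, hessian M b μ (v x) (v y) = r x * r y * if x = y then val x else 0 := by
    intro x y
    rw [(hr x).2, (hr y).2, LinearMap.BilinForm.smul_left, LinearMap.BilinForm.smul_right,
      L.hessian_basis hval, mul_assoc]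
  refine ⟨fun x y hxy => ?_, fun x => ⟨r x, (hr x).1, (hr x).2, ?_⟩⟩
  · rw [h, if_neg hxy, mul_zero]
  · rw [h, if_pos rfl, sq]

end StratumSystem

end Frames

/-! ## Skew extensions -/

section Skew

variable {E : Type*} [NormedAddCommGroup E] [InnerProductSpace ℝ E]

/-- Split `Y s` into a part in the span of `e` and a normal part `N s`. The first part is skew by
hypothesis; the second becomes skew after subtracting the transposes `⟨N s, ·⟩ e s`, which vanish on
the span of `e`. -/
theorem exists_skew {σ : Type*} [Fintype σ] {e Y : σ → E} (he : Orthonormal ℝ e)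
    (hY : ∀ i j, (inner ℝ (Y i) (e j) + inner ℝ (e i) (Y j) : ℝ) = 0) :
    ∃ Z : E →L[ℝ] E, (∀ x y, (inner ℝ (Z x) y : ℝ) = -inner ℝ x (Z y)) ∧ ∀ i, Z (e i) = Y i := by
  classical
  have hee := orthonormal_iff_ite.mp he
  let N : σ → E := fun s => Y s - ∑ t, (inner ℝ (Y s) (e t) : ℝ) • e t
  have hN : ∀ s r, (inner ℝ (N s) (e r) : ℝ) = 0 := fun s r => by
    simp [N, inner_sub_left, sum_inner, real_inner_smul_left, hee]
  have hYN : ∀ s, Y s = N s + ∑ t, (inner ℝ (Y s) (e t) : ℝ) • e t := fun s => by simp [N]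
  let Z : E →L[ℝ] E := ∑ s, (rk (e s) (Y s) - rk (N s) (e s))
  have hZ : ∀ v, Z v = ∑ s, ((inner ℝ (e s) v : ℝ) • Y s - (inner ℝ (N s) v : ℝ) • e s) :=
    fun v => by simp [Z]
  refine ⟨Z, fun x y => ?_, fun i => ?_⟩
  · have key : ∀ x y, (inner ℝ (Z x) y : ℝ) =
        ∑ s, (inner ℝ (e s) x * inner ℝ (N s) y - inner ℝ (N s) x * inner ℝ (e s) y) +
          ∑ s, ∑ t, inner ℝ (Y s) (e t) * (inner ℝ (e s) x * inner ℝ (e t) y) := by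
      intro x y
      rw [hZ, sum_inner, ← Finset.sum_add_distrib]
      refine Finset.sum_congr rfl fun s _ => ?_
      conv_lhs => rw [hYN s]
      simp only [inner_sub_left, inner_add_left, sum_inner, real_inner_smul_left, mul_add,
        Finset.mul_sum]
      rw [add_sub_right_comm]
      congr 1
      exact Finset.sum_congr rfl fun t _ => by ring
    have h1 : ∑ s, ∑ t, inner ℝ (Y s) (e t) * ((inner ℝ (e s) y : ℝ) * inner ℝ (e t) x) =
        -∑ s, ∑ t, inner ℝ (Y s) (e t) * ((inner ℝ (e s) x : ℝ) * inner ℝ (e t) y) := by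
      rw [Finset.sum_comm, ← Finset.sum_neg_distrib]
      refine Finset.sum_congr rfl fun s _ => ?_
      rw [← Finset.sum_neg_distrib]
      refine Finset.sum_congr rfl fun t _ => ?_
      have := hY s t
      rw [real_inner_comm (Y t)] at this
      rw [show (inner ℝ (Y t) (e s) : ℝ) = -inner ℝ (Y s) (e t) by linarith]
      ring
    rw [real_inner_comm (Z y), key x y, key y x, h1, neg_add, neg_neg, ← Finset.sum_neg_distrib]
    congr 1
    exact Finset.sum_congr rfl fun s _ => by ring
  · rw [hZ]
    simp only [hN, zero_smul, sub_zero, hee, ite_smul, one_smul]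
    simp

end Skew

/-! ## Rotations of frames -/

section Rotation

variable {E : Type*} [NormedAddCommGroup E] [InnerProductSpace ℝ E] {k : ℕ}

open Classical in
/-- The rotation of the vectors of a frame towards given directions. -/
def rot (e y : Fin k → E) (t : ℝ) : Fin k → E :=
  -- A vector without a direction of motion has to stay fixed instead of being scaled by `cos t`.
  fun a => if y a = 0 then e a else Real.cos t • e a + Real.sin t • y a

theorem rot_of_eq_zero {e y : Fin k → E} {a : Fin k} (h : y a = 0) (t : ℝ) :
    rot e y t a = e a := if_pos h

theorem rot_of_ne_zero {e y : Fin k → E} {a : Fin k} (h : y a ≠ 0) (t : ℝ) :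
    rot e y t a = Real.cos t • e a + Real.sin t • y a := if_neg h

theorem rot_zero (e y : Fin k → E) : rot e y 0 = e := by
  funext a
  by_cases h : y a = 0
  · rw [rot_of_eq_zero h]
  · simp [rot_of_ne_zero h]

theorem contDiff_rot (e y : Fin k → E) : ContDiff ℝ ∞ (rot e y) := by
  refine contDiff_pi.mpr fun a => ?_
  by_cases h : y a = 0
  · simp only [rot_of_eq_zero h]
    exact contDiff_const
  · simp only [rot_of_ne_zero h]
    exact (Real.contDiff_cos.smul contDiff_const).add (Real.contDiff_sin.smul contDiff_const)

theorem hasDerivAt_rot (e y : Fin k → E) : HasDerivAt (rot e y) y 0 := by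
  refine hasDerivAt_pi.mpr fun a => ?_
  by_cases h : y a = 0
  · simp only [rot_of_eq_zero h, h]
    exact hasDerivAt_const _ _
  · simp only [rot_of_ne_zero h]
    have := ((Real.hasDerivAt_cos 0).smul_const (e a)).fun_add
      ((Real.hasDerivAt_sin 0).smul_const (y a))
    simpa using this

theorem rot_mem {e y : Fin k → E} {a : Fin k} {W : Submodule ℝ E} (he : e a ∈ W) (hy : y a ∈ W)
    (t : ℝ) : rot e y t a ∈ W := by
  by_cases h : y a = 0
  · rwa [rot_of_eq_zero h]
  · rw [rot_of_ne_zero h]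
    exact W.add_mem (W.smul_mem _ he) (W.smul_mem _ hy)

/-- `y` preserves infinitesimally the values of the form `β` on the frame `e`. -/
def Infinitesimal (β : E →ₗ[ℝ] E →ₗ[ℝ] ℝ) (e y : Fin k → E) : Prop :=
  ∀ i j, β (y i) (e j) + β (e i) (y j) = 0

/-- If both vectors rotate, the mixed terms cancel by `hy` and `cos² + sin² = 1` does the rest. If
only one rotates, the indices differ and all terms are zero. It serves for the inner product and for
the symplectic form. -/
theorem rot_preserves {β : E →ₗ[ℝ] E →ₗ[ℝ] ℝ} {e y : Fin k → E}
    (hy : Infinitesimal β e y) (he : ∀ i j, i ≠ j → β (e i) (e j) = 0)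
    (hyy : ∀ i j, y i ≠ 0 → y j ≠ 0 → β (y i) (y j) = β (e i) (e j)) (t : ℝ) (i j : Fin k) :
    β (rot e y t i) (rot e y t j) = β (e i) (e j) := by
  have hij := hy i j
  by_cases hi : y i = 0 <;> by_cases hj : y j = 0
  · rw [rot_of_eq_zero hi, rot_of_eq_zero hj]
  · have hne : i ≠ j := fun h => hj (h ▸ hi)
    rw [hi, map_zero, LinearMap.zero_apply, zero_add] at hij
    rw [rot_of_eq_zero hi, rot_of_ne_zero hj]
    simp [he i j hne, hij]
  · have hne : i ≠ j := fun h => hi (h ▸ hj)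
    rw [hj, map_zero, add_zero] at hij
    rw [rot_of_ne_zero hi, rot_of_eq_zero hj]
    simp [he i j hne, hij]
  · rw [rot_of_ne_zero hi, rot_of_ne_zero hj]
    simp only [map_add, map_smul, LinearMap.add_apply, LinearMap.smul_apply, smul_eq_mul,
      hyy i j hi hj]
    linear_combination Real.cos t * Real.sin t * hij +
      β (e i) (e j) * Real.cos_sq_add_sin_sq t

variable {β : E →ₗ[ℝ] E →ₗ[ℝ] ℝ} {ε : ℝ}

/-- The scalar `ε` treats symmetric forms (`ε = 1`) and alternating forms (`ε = -1`) together. -/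
theorem infinitesimal_single (hβ : ∀ x y, β y x = ε * β x y) {e : Fin k → E} {i : Fin k} {f : E}
    (hf : ∀ b, b ≠ i → β f (e b) = 0) (hfi : β f (e i) + β (e i) f = 0) :
    Infinitesimal β e (Pi.single i f) := by
  have hf' : ∀ b, b ≠ i → β (e b) f = 0 := fun b hb => by rw [hβ, hf b hb, mul_zero]
  intro a b
  by_cases ha : a = i
  · subst ha
    by_cases hb : b = a
    · subst hb
      simpa using hfi
    · simp [hb, hf b hb]
  · by_cases hb : b = i
    · subst hb
      simp [ha, hf' a ha]
    · simp [ha, hb]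

theorem infinitesimal_add_single (hβ : ∀ x y, β y x = ε * β x y) {e : Fin k → E} {i j : Fin k}
    (hij : i ≠ j) {f g : E}
    (hf : ∀ b, b ≠ j → β f (e b) = 0) (hg : ∀ b, b ≠ i → β g (e b) = 0)
    (hfg : β f (e j) + β (e i) g = 0) :
    Infinitesimal β e (Pi.single i f + Pi.single j g) := by
  have hf' : ∀ b, b ≠ j → β (e b) f = 0 := fun b hb => by rw [hβ, hf b hb, mul_zero]
  have hg' : ∀ b, b ≠ i → β (e b) g = 0 := fun b hb => by rw [hβ, hg b hb, mul_zero]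
  have hfg' : β g (e i) + β (e j) f = 0 := by
    rw [hβ (e i) g, hβ f (e j)]
    linear_combination ε * hfg
  have hi : (Pi.single i f + Pi.single j g : Fin k → E) i = f := by simp [hij]
  have hj : (Pi.single i f + Pi.single j g : Fin k → E) j = g := by simp [hij.symm]
  have ho : ∀ c, c ≠ i → c ≠ j → (Pi.single i f + Pi.single j g : Fin k → E) c = 0 :=
    fun c h h' => by simp [h, h']
  intro a b
  by_cases hai : a = i
  · subst hai
    by_cases hbj : b = j
    · subst hbj
      rw [hi, hj, hfg]
    · rw [hi, hf b hbj, zero_add]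
      by_cases hba : b = a
      · subst hba
        rw [hi, hf' b hij]
      · rw [ho b hba hbj, map_zero]
  · by_cases haj : a = j
    · subst haj
      by_cases hbi : b = i
      · subst hbi
        rw [hi, hj, hfg']
      · rw [hj, hg b hbi, zero_add]
        by_cases hba : b = a
        · subst hba
          rw [hj, hg' b hai]
        · rw [ho b hbi hba, map_zero]
    · rw [ho a hai haj, map_zero, LinearMap.zero_apply, zero_add]
      by_cases hbi : b = i
      · rw [hbi, hi, hf' a haj]
      · by_cases hbj : b = j
        · rw [hbj, hj, hg' a hai]
        · rw [ho b hbi hbj, map_zero]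

theorem single_pairing {e : Fin k → E} {i : Fin k} {f : E} (hf : β f f = β (e i) (e i))
    (a b : Fin k) (ha : (Pi.single i f : Fin k → E) a ≠ 0)
    (hb : (Pi.single i f : Fin k → E) b ≠ 0) :
    β ((Pi.single i f : Fin k → E) a) ((Pi.single i f : Fin k → E) b) = β (e a) (e b) := by
  have h1 : a = i := by
    by_contra h
    exact ha (by simp [h])
  have h2 : b = i := by
    by_contra h
    exact hb (by simp [h])
  subst h1 h2
  simpa using hf

theorem add_single_pairing (hβ : ∀ x y, β y x = ε * β x y) {e : Fin k → E} {i j : Fin k}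
    (hij : i ≠ j) {f g : E} (hf : β f f = β (e i) (e i)) (hg : β g g = β (e j) (e j))
    (hfg : β f g = β (e i) (e j)) (a b : Fin k)
    (ha : (Pi.single i f + Pi.single j g : Fin k → E) a ≠ 0)
    (hb : (Pi.single i f + Pi.single j g : Fin k → E) b ≠ 0) :
    β ((Pi.single i f + Pi.single j g : Fin k → E) a)
      ((Pi.single i f + Pi.single j g : Fin k → E) b) = β (e a) (e b) := by
  have hgf : β g f = β (e j) (e i) := by rw [hβ f g, hfg, ← hβ]
  have key : ∀ c, (Pi.single i f + Pi.single j g : Fin k → E) c ≠ 0 → c = i ∨ c = j := by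
    intro c hc
    by_contra! h
    exact hc (by rw [Pi.add_apply, Pi.single_eq_of_ne h.1, Pi.single_eq_of_ne h.2, add_zero])
  have hi : (Pi.single i f + Pi.single j g : Fin k → E) i = f := by
    rw [Pi.add_apply, Pi.single_eq_same, Pi.single_eq_of_ne hij, add_zero]
  have hj : (Pi.single i f + Pi.single j g : Fin k → E) j = g := by
    rw [Pi.add_apply, Pi.single_eq_same, Pi.single_eq_of_ne hij.symm, zero_add]
  rcases key a ha with rfl | rfl <;> rcases key b hb with rfl | rfl <;> simp only [hi, hj] <;>
    assumption

theorem update_eq_rot_single {e : Fin k → E} {i : Fin k} {f : E} (hf : f ≠ 0) (t : ℝ) :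
    Function.update e i (Real.cos t • e i + Real.sin t • f) = rot e (Pi.single i f) t := by
  funext a
  by_cases h : a = i
  · subst h
    rw [rot_of_ne_zero (by simpa using hf)]
    simp
  · rw [rot_of_eq_zero (by simp [h]), Function.update_of_ne h]

theorem update_update_eq_rot {e : Fin k → E} {i j : Fin k} (hij : i ≠ j) {f g : E} (hf : f ≠ 0)
    (hg : g ≠ 0) (t : ℝ) :
    Function.update (Function.update e i (Real.cos t • e i + Real.sin t • f)) j
      (Real.cos t • e j + Real.sin t • g) = rot e (Pi.single i f + Pi.single j g) t := by
  funext a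
  by_cases hj : a = j
  · subst hj
    rw [rot_of_ne_zero (by simpa [hij.symm] using hg)]
    simp [hij.symm]
  · rw [Function.update_of_ne hj]
    by_cases hi : a = i
    · subst hi
      rw [rot_of_ne_zero (by simpa [hj] using hf)]
      simp [hj]
    · rw [rot_of_eq_zero (by simp [hi, hj]), Function.update_of_ne hi]

theorem orthonormal_rot {e y : Fin k → E} (he : Orthonormal ℝ e)
    (hy : Infinitesimal (innerₗ E) e y)
    (hyy : ∀ i j, y i ≠ 0 → y j ≠ 0 → innerₗ E (y i) (y j) = innerₗ E (e i) (e j)) (t : ℝ) :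
    Orthonormal ℝ (rot e y t) := by
  rw [orthonormal_iff_ite] at he ⊢
  intro i j
  rw [← he i j]
  exact rot_preserves hy (fun i j h => by rw [innerₗ_apply_apply, he i j, if_neg h]) hyy t i j

end Rotation

/-! ## Counting signs -/

section Counting

variable {Λ : Type} [Finite Λ] {q val : Λ → ℝ} {p : Λ → Prop}

/-- Factors `r ^ 2` with `r ≠ 0` keep signs, and no value is zero, so `p` and its negation describe
the positive and the negative entries. -/
theorem card_pos_neg (hq : ∀ x, ∃ r : ℝ, r ≠ 0 ∧ q x = r ^ 2 * val x)
    (hpos : ∀ x, p x → 0 < val x) (hneg : ∀ x, ¬ p x → val x < 0) :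
    Nat.card {x // 0 < q x} = Nat.card {x // p x} ∧
      Nat.card {x // q x < 0} + Nat.card {x // p x} = Nat.card Λ := by
  classical
  have := Fintype.ofFinite Λ
  have hqpos : ∀ x, p x → 0 < q x := fun x hx => by
    obtain ⟨r, hr, h⟩ := hq x
    have := hpos x hx
    rw [h]
    positivity
  have hqneg : ∀ x, ¬ p x → q x < 0 := fun x hx => by
    obtain ⟨r, hr, h⟩ := hq x
    have := hneg x hx
    rw [h]
    exact mul_neg_of_pos_of_neg (by positivity) this
  have h1 : ∀ x, 0 < q x ↔ p x := fun x =>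
    ⟨fun h => by_contra fun hx => (hqneg x hx).not_gt h, hqpos x⟩
  have h2 : ∀ x, q x < 0 ↔ ¬ p x := fun x =>
    ⟨fun h hx => (hqpos x hx).not_gt h, hqneg x⟩
  simp only [h1, h2, true_and]
  rw [add_comm, ← Nat.card_sum]
  exact Nat.card_congr (Equiv.sumCompl p)

theorem card_neg_pos (hq : ∀ x, ∃ r : ℝ, r ≠ 0 ∧ q x = r ^ 2 * val x)
    (hneg : ∀ x, p x → val x < 0) (hpos : ∀ x, ¬ p x → 0 < val x) :
    Nat.card {x // q x < 0} = Nat.card {x // p x} ∧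
      Nat.card {x // 0 < q x} + Nat.card {x // p x} = Nat.card Λ := by
  have := card_pos_neg (q := fun x => -q x) (val := fun x => -val x) (p := p)
    (fun x => by
      obtain ⟨r, hr, h⟩ := hq x
      exact ⟨r, hr, by rw [h]; ring⟩)
    (fun x hx => neg_pos.mpr (hneg x hx)) (fun x hx => neg_neg_iff_pos.mpr (hpos x hx))
  simpa only [neg_pos, neg_neg_iff_pos, Left.neg_neg_iff] using this

end Counting

/-! ## Symmetric matrices with an orthonormal eigenbasis -/

section Matrices

variable {ι : Type} [Fintype ι] [DecidableEq ι]

theorem inner_transpose_toEuclideanLin (A : Matrix ι ι ℝ) (x y : EuclideanSpace ℝ ι) :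
    (inner ℝ (A.transpose.toEuclideanLin x) y : ℝ) = inner ℝ x (A.toEuclideanLin y) := by
  rw [← Matrix.conjTranspose_eq_transpose_of_trivial,
    Matrix.toEuclideanLin_conjTranspose_eq_adjoint, LinearMap.adjoint_inner_left]

theorem toEuclideanLin_mul (A B : Matrix ι ι ℝ) (x : EuclideanSpace ℝ ι) :
    (A * B).toEuclideanLin x = A.toEuclideanLin (B.toEuclideanLin x) := by
  simp [Matrix.toLpLin_apply]

theorem gram_symm (A : Matrix ι ι ℝ) (x y : EuclideanSpace ℝ ι) :
    (inner ℝ ((A.transpose * A).toEuclideanLin x) y : ℝ) =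
      inner ℝ x ((A.transpose * A).toEuclideanLin y) := by
  rw [← inner_transpose_toEuclideanLin, Matrix.transpose_mul, Matrix.transpose_transpose]

/-- An orthonormal eigenbasis makes `A` symmetric: comparing coordinates, the transpose has the same
eigenvectors and eigenvalues. -/
theorem gram_eigen {A : Matrix ι ι ℝ} {u : OrthonormalBasis ι ℝ (EuclideanSpace ℝ ι)}
    {lam : ι → ℝ} (h : ∀ a, A.toEuclideanLin (u a) = lam a • u a) (a : ι) :
    (A.transpose * A).toEuclideanLin (u a) = lam a ^ 2 • u a := by
  rw [toEuclideanLin_mul, h, map_smul, sq, mul_smul]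
  congr 1
  apply u.repr.injective
  ext c
  rw [u.repr_apply_apply, u.repr_apply_apply, real_inner_comm, inner_transpose_toEuclideanLin, h,
    real_inner_smul_right, real_inner_smul_right, u.inner_eq_ite, u.inner_eq_ite]
  by_cases hac : a = c
  · rw [hac]
  · rw [if_neg hac, if_neg (Ne.symm hac), mul_zero, mul_zero]

end Matrices

/-! ## Counting pairs -/

section Pairs

theorem card_sum_subtype {α β : Type} [Finite α] [Finite β] (p : α ⊕ β → Prop) :
    Nat.card {x // p x} = Nat.card {a // p (.inl a)} + Nat.card {b // p (.inr b)} := by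
  rw [← Nat.card_sum]
  exact Nat.card_congr (Equiv.subtypeSum)

theorem card_subtype_subtype {α : Type} (p q : α → Prop) :
    Nat.card {x : {a // p a} // q x.1} = Nat.card {a // p a ∧ q a} :=
  Nat.card_congr (Equiv.subtypeSubtypeEquivSubtypeInter p q)

theorem card_lt_pairs (k : ℕ) : Nat.card {p : Fin k × Fin k // p.1 < p.2} * 2 = k * (k - 1) := by
  have h : Nat.card {p : Fin k × Fin k // p.1 < p.2} = Nat.card (Σ j : Fin k, {i // i < j}) :=
    Nat.card_congr
      { toFun := fun p => ⟨p.1.2, p.1.1, p.2⟩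
        invFun := fun p => ⟨(p.2.1, p.1), p.2.2⟩
        left_inv := fun _ => rfl
        right_inv := fun _ => rfl }
  rw [h, Nat.card_eq_fintype_card, Fintype.card_sigma]
  have : ∀ j : Fin k, Fintype.card {i // i < j} = (j : ℕ) := fun j => by
    rw [Fintype.card_subtype, ← Fin.card_Iio j]
    congr 1
    ext i
    simp
  simp only [this]
  rw [Fin.sum_univ_eq_sum_range (fun i => i), Finset.sum_range_id_mul_two]

theorem card_pairs {α β : Type} (q : β → Prop) :
    Nat.card {p : α × β // q p.2} = Nat.card α * Nat.card {b // q b} := by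
  rw [← Nat.card_prod]
  exact Nat.card_congr
    { toFun := fun p => (p.1.1, ⟨p.1.2, p.2⟩)
      invFun := fun p => ⟨(p.1, p.2.1), p.2.2⟩
      left_inv := fun _ => rfl
      right_inv := fun _ => rfl }

theorem card_notMem_range {ι σ : Type} [Finite ι] {f : σ → ι} (hf : f.Injective) :
    Nat.card {a // a ∉ Set.range f} + Nat.card σ = Nat.card ι := by
  classical
  rw [Nat.card_congr (Equiv.ofInjective f hf), add_comm, ← Nat.card_sum]
  exact Nat.card_congr (Equiv.sumCompl _)

end Pairs

/-! ## The flag manifold of `ℝⁿ` -/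

section General

variable {n k : ℕ} (u : OrthonormalBasis (Fin n) ℝ (EuclideanSpace ℝ (Fin n)))
  (π : Fin k ↪ Fin n)

theorem card_link : Nat.card (Link π) = k * (2 * n - k - 1) / 2 := by
  rw [Nat.card_sum, card_pairs (fun j => j ∉ Set.range π), Nat.card_eq_fintype_card (α := Fin k),
    Fintype.card_fin]
  have h1 := card_notMem_range π.injective
  have h2 := card_lt_pairs k
  simp only [Nat.card_eq_fintype_card (α := Fin _), Fintype.card_fin] at h1
  symm
  apply Nat.div_eq_of_eq_mul_left two_pos
  rw [add_mul, h2]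
  generalize Nat.card {a // a ∉ Set.range π} = m at h1
  -- The natural subtraction `2 * n - k - 1` is harmless: for `k = 0` the product vanishes, and for
  -- positive `k` injectivity of `π` gives `k ≤ n`.
  rcases k with - | k
  · simp
  · rw [show 2 * n - (k + 1) - 1 = 2 * m + k by omega, Nat.add_sub_cancel]
    ring

/-- The index of the line that is moved, and the direction in which it is moved. -/
def linkKey : Link π → Fin k × Fin n
  | .inl p => p.1
  | .inr p => (p.1.1, π p.1.2)

/-- The derivative of `linkFrame`. -/
def linkDir : Link π → Fin k → EuclideanSpace ℝ (Fin n)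
  | .inl p => Pi.single p.1.1 (u p.1.2)
  | .inr p => Pi.single p.1.1 (u (π p.1.2)) + Pi.single p.1.2 (-u (π p.1.1))

/-- Coordinates dual to `linkDir`. -/
def linkCoord : (Fin k → EuclideanSpace ℝ (Fin n)) →ₗ[ℝ] (Link π → ℝ) :=
  -- For a pair `i < j` only the component of `Y i` along `u (π j)` is read; skewness determines
  -- that of `Y j` along `u (π i)`.
  LinearMap.pi fun x => innerₗ _ (u (linkKey π x).2) ∘ₗ LinearMap.proj (linkKey π x).1

theorem linkCoord_apply (Y : Fin k → EuclideanSpace ℝ (Fin n)) (x : Link π) :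
    linkCoord u π Y x = inner ℝ (u (linkKey π x).2) (Y (linkKey π x).1) := rfl

theorem linkFrame_eq_rot (x : Link π) :
    linkFrame u π x = rot (fun i => u (π i)) (linkDir u π x) := by
  funext t
  rcases x with p | p
  · exact update_eq_rot_single (e := fun i => u (π i)) (u.orthonormal.ne_zero _) t
  · rw [linkDir, ← update_update_eq_rot p.2.ne (u.orthonormal.ne_zero _)
      (neg_ne_zero.mpr (u.orthonormal.ne_zero _)), smul_neg, ← sub_eq_add_neg]
    rfl

theorem mem_linkSets_inl (p : {p : Fin k × Fin n // p.2 ∉ Set.range π}) (i : Fin k) (a : Fin n) :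
    a ∈ linkSets π (.inl p) i ↔ a = π i ∨ i = p.1.1 ∧ a = p.1.2 := by
  simp only [linkSets, Function.update_apply]
  split_ifs with h <;> simp [h]

theorem mem_linkSets_inr (p : {p : Fin k × Fin k // p.1 < p.2}) (i : Fin k) (a : Fin n) :
    a ∈ linkSets π (.inr p) i ↔
      a = π i ∨ i = p.1.1 ∧ a = π p.1.2 ∨ i = p.1.2 ∧ a = π p.1.1 := by
  have := p.2.ne
  simp only [linkSets, Function.update_apply]
  split_ifs with h h'
  · simp [h, this.symm, or_comm]
  · simp [h', this]
  · simp [h, h']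

theorem self_mem_linkSets (x : Link π) (i : Fin k) : π i ∈ linkSets π x i := by
  rcases x with p | p
  · rw [mem_linkSets_inl]
    exact Or.inl rfl
  · rw [mem_linkSets_inr]
    exact Or.inl rfl

/-- The combinatorial content of `coord_eq_zero`. For two pairs, the circle also contains the key of
the reversed pair, which is excluded by `i < j`. -/
theorem linkKey_notMem {x z : Link π} (h : z ≠ x) :
    (linkKey π z).2 ∉ linkSets π x (linkKey π z).1 := by
  rcases x with p | p <;> rcases z with q | q <;>
    simp only [mem_linkSets_inl, mem_linkSets_inr, linkKey, EmbeddingLike.apply_eq_iff_eq]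
  · rintro (h1 | ⟨h1, h2⟩)
    · exact q.2 ⟨_, h1.symm⟩
    · exact h (congrArg Sum.inl (Subtype.ext (Prod.ext h1 h2)))
  · rintro (h1 | ⟨h1, h2⟩)
    · exact q.2.ne' h1
    · exact p.2 ⟨_, h2⟩
  · rintro (h1 | ⟨-, h1⟩ | ⟨-, h1⟩) <;> exact q.2 ⟨_, h1.symm⟩
  · rintro (h1 | ⟨h1, h2⟩ | ⟨h1, h2⟩)
    · exact q.2.ne' h1
    · exact h (congrArg Sum.inr (Subtype.ext (Prod.ext h1 h2)))
    · have h3 := p.2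
      have h4 := q.2
      rw [h1, h2] at h4
      exact lt_asymm h3 h4

theorem linkDir_mem_span (x : Link π) (i : Fin k) :
    linkDir u π x i ∈ Submodule.span ℝ (u '' linkSets π x i) := by
  have hu : ∀ a, a ∈ linkSets π x i → u a ∈ Submodule.span ℝ (u '' linkSets π x i) :=
    fun a ha => Submodule.subset_span ⟨a, ha, rfl⟩
  rcases x with p | p
  · rw [linkDir, Pi.single_apply]
    split_ifs with h
    · exact hu _ ((mem_linkSets_inl π p i _).mpr (Or.inr ⟨h, rfl⟩))
    · exact Submodule.zero_mem _
  · rw [linkDir, Pi.add_apply, Pi.single_apply, Pi.single_apply]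
    refine Submodule.add_mem _ ?_ ?_
    · split_ifs with h
      · exact hu _ ((mem_linkSets_inr π p i _).mpr (Or.inr (Or.inl ⟨h, rfl⟩)))
      · exact Submodule.zero_mem _
    · split_ifs with h
      · exact Submodule.neg_mem _ (hu _ ((mem_linkSets_inr π p i _).mpr (Or.inr (Or.inr ⟨h, rfl⟩))))
      · exact Submodule.zero_mem _

theorem linkDir_infinitesimal (x : Link π) :
    Infinitesimal (innerₗ (EuclideanSpace ℝ (Fin n))) (fun i => u (π i)) (linkDir u π x) ∧
    ∀ i j, linkDir u π x i ≠ 0 → linkDir u π x j ≠ 0 →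
      innerₗ (EuclideanSpace ℝ (Fin n)) (linkDir u π x i) (linkDir u π x j) =
        innerₗ (EuclideanSpace ℝ (Fin n)) (u (π i)) (u (π j)) := by
  have hβ : ∀ x y, innerₗ (EuclideanSpace ℝ (Fin n)) y x = 1 * innerₗ _ x y := fun x y => by
    rw [one_mul]
    exact real_inner_comm x y
  rcases x with p | p
  · have h : ∀ b, innerₗ (EuclideanSpace ℝ (Fin n)) (u p.1.2) (u (π b)) = 0 := fun b => by
      simp only [innerₗ_apply_apply, u.inner_eq_ite]
      rw [if_neg fun h => p.2 ⟨b, h.symm⟩]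
    refine ⟨infinitesimal_single hβ (fun b _ => h b) ?_,
      single_pairing (e := fun i => u (π i)) ?_⟩
    · rw [hβ (u p.1.2) (u (π p.1.1)), h, mul_zero, add_zero]
    · simp
  · have hne := p.2.ne
    refine ⟨infinitesimal_add_single hβ hne (fun b hb => ?_) (fun b hb => ?_) ?_,
      add_single_pairing (e := fun i => u (π i)) hβ hne ?_ ?_ ?_⟩
    · simp [innerₗ_apply_apply, u.inner_eq_ite, hb.symm]
    · simp [innerₗ_apply_apply, u.inner_eq_ite, hb.symm]
    · simp [innerₗ_apply_apply]
    · simp [innerₗ_apply_apply]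
    · simp [innerₗ_apply_apply]
    · simp [innerₗ_apply_apply, u.inner_eq_ite, hne, hne.symm]

theorem linkFrame_orthonormal (x : Link π) (t : ℝ) : Orthonormal ℝ (linkFrame u π x t) := by
  rw [linkFrame_eq_rot]
  exact orthonormal_rot (u.orthonormal.comp π π.injective) (linkDir_infinitesimal u π x).1
    (linkDir_infinitesimal u π x).2 t

/-- The one-dimensional strata through `V_π` in the flag manifold of `ℝⁿ`. -/
def linkSystem : StratumSystem (Link π) u π Set.univ (fun x => stratum u (linkSets π x))
    (linkFrame u π) where
  K := skewSpace fun i => u (π i)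
  K_le := le_rfl
  mem_K γ X Y _ hX0 hX hY := by
    rw [← hX0]
    exact mem_skewSpace_of_hasDerivAt hY (hX.mono fun t ht => ht.1)
  exists_curve Y hY := by
    -- The curve is the orbit of the frame under the one-parameter group of isometries generated by
    -- `Z`.
    obtain ⟨Z, hZ, hZe⟩ := exists_skew (u.orthonormal.comp π π.injective) hY
    refine ⟨fun t i => NormedSpace.exp (t • Z) (u (π i)), fun t => ?_,
      contDiff_pi.mpr fun i => contDiff_exp_apply Z _, fun t => Set.mem_univ _, ?_,
      hasDerivAt_pi.mpr fun i => ?_⟩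
    · rw [orthonormal_iff_ite]
      intro i j
      rw [inner_exp_of_skew hZ]
      exact orthonormal_iff_ite.mp (u.orthonormal.comp π π.injective) i j
    · funext i
      exact exp_zero_smul_apply Z _
    · rw [← hZe i]
      exact hasDerivAt_exp_apply Z _
  coord := linkCoord u π
  coord_inj Y hY h := by
    have hsk : ∀ i j, (inner ℝ (Y i) (u (π j)) + inner ℝ (u (π i)) (Y j) : ℝ) = 0 := hY
    have hlt : ∀ i j, i < j → (inner ℝ (u (π j)) (Y i) : ℝ) = 0 := fun i j hij =>
      congrFun h (.inr ⟨(i, j), hij⟩)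
    funext i
    apply u.repr.injective
    ext a
    rw [u.repr_apply_apply, Pi.zero_apply, map_zero]
    by_cases ha : a ∈ Set.range π
    · obtain ⟨j, rfl⟩ := ha
      have h1 := hsk i j
      rw [real_inner_comm] at h1
      rcases lt_trichotomy i j with hij | rfl | hij
      · exact hlt i j hij
      · change (inner ℝ (u (π i)) (Y i) : ℝ) = 0
        linarith
      · rw [hlt j i hij, add_zero] at h1
        exact h1
    · exact congrFun h (.inl ⟨(i, a), ha⟩)
  sets := linkSets π
  str_subset _ := Set.subset_univ _
  str_subset_stratum _ := subset_rfl
  coord_eq_zero x z hzx Y hY := hY _ _ (linkKey_notMem π hzx)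
  smooth x := by
    rw [linkFrame_eq_rot]
    exact contDiff_rot _ _
  orthonormal := linkFrame_orthonormal u π
  mem_str x t := by
    refine ⟨_, isFrame_ofFrame _ _, fun i => ?_⟩
    rw [linkFrame_eq_rot]
    exact rot_mem (e := fun i => u (π i)) (Submodule.subset_span (s := u '' linkSets π x i)
      ⟨_, self_mem_linkSets π x i, rfl⟩)
      (linkDir_mem_span u π x i) t
  frame_zero x := by
    rw [linkFrame_eq_rot]
    exact rot_zero _ _
  dir := linkDir u π
  hasDerivAt x := by
    rw [linkFrame_eq_rot]
    exact hasDerivAt_rot _ _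
  coord_dir_self x := by
    rw [linkCoord_apply]
    rcases x with p | p
    · simp [linkKey, linkDir]
    · simp [linkKey, linkDir, p.2.ne]

/-! ### Values and signs of the Hessian for general flags. -/

theorem hform_linkDir {M : Matrix (Fin n) (Fin n) ℝ} {lam : Fin n → ℝ} (b : Fin k → ℝ)
    (hM : ∀ a, M.toEuclideanLin (u a) = lam a ^ 2 • u a) (x : Link π)
    (Y : Fin k → EuclideanSpace ℝ (Fin n)) (hY : Y ∈ (linkSystem u π).K) :
    hform M b (fun i => lam (π i) ^ 2) ((linkSystem u π).dir x) Y =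
      linkValue lam b π x * (linkSystem u π).coord Y x := by
  change hform M b (fun i => lam (π i) ^ 2) (linkDir u π x) Y =
    linkValue lam b π x * linkCoord u π Y x
  rw [linkCoord_apply]
  rcases x with p | p
  · exact hform_single b _ (hM _) Y
  · have hM' : M.toEuclideanLin (-u (π p.1.1)) = lam (π p.1.1) ^ 2 • -u (π p.1.1) := by
      rw [map_neg, hM, smul_neg]
    have h1 : (inner ℝ (Y p.1.1) (u (π p.1.2)) + inner ℝ (u (π p.1.1)) (Y p.1.2) : ℝ) = 0 :=
      hY p.1.1 p.1.2
    rw [real_inner_comm] at h1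
    rw [linkDir, map_add, LinearMap.add_apply, hform_single b _ (hM _), hform_single b _ hM',
      inner_neg_left, linkValue]
    simp only [linkKey]
    -- By skewness both summands are multiples of the same coordinate, with eigenvalue differences
    -- of opposite sign; this produces `b_i² - b_j²`.
    linear_combination (-2 * (k : ℝ)⁻¹ * b p.1.2 ^ 2 * (lam (π p.1.1) ^ 2 - lam (π p.1.2) ^ 2)) * h1

theorem linkKey_ne (x : Link π) : (linkKey π x).2 ≠ π (linkKey π x).1 := by
  rcases x with p | p
  · exact fun h => p.2 ⟨_, h.symm⟩
  · exact fun h => p.2.ne' (π.injective h)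

theorem card_link_inversions :
    Nat.card {x : Link π // (linkKey π x).2 < π (linkKey π x).1} = inversionCount π := by
  rw [card_sum_subtype]
  simp only [linkKey]
  rw [card_subtype_subtype (fun p : Fin k × Fin n => p.2 ∉ Set.range π) fun p => p.2 < π p.1,
    card_subtype_subtype (fun p : Fin k × Fin k => p.1 < p.2) fun p => π p.2 < π p.1]
  rfl

variable {π} {lam : Fin n → ℝ} {b : Fin k → ℝ}

theorem linkValue_pos (hb : ∀ i, 0 < b i) (hb' : StrictAnti b) (hlam : ∀ a, 0 < lam a)
    {x : Link π} (h : lam (π (linkKey π x).1) < lam (linkKey π x).2) : 0 < linkValue lam b π x := by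
  have hsq := sub_pos.mpr (pow_lt_pow_left₀ h (hlam _).le two_ne_zero)
  -- The key of `x` contains an element of `Fin k`, so `k` is positive.
  have hk : 0 < (k : ℝ)⁻¹ := inv_pos.mpr (Nat.cast_pos.mpr (linkKey π x).1.pos)
  rcases x with p | p
  · exact mul_pos (mul_pos (mul_pos two_pos hk) (pow_pos (hb _) 2)) hsq
  · have := sub_pos.mpr (pow_lt_pow_left₀ (hb' p.2) (hb _).le two_ne_zero)
    exact mul_pos (mul_pos (mul_pos two_pos hk) this) hsq

theorem linkValue_neg (hb : ∀ i, 0 < b i) (hb' : StrictAnti b) (hlam : ∀ a, 0 < lam a)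
    {x : Link π} (h : lam (linkKey π x).2 < lam (π (linkKey π x).1)) : linkValue lam b π x < 0 := by
  have hsq := sub_neg.mpr (pow_lt_pow_left₀ h (hlam _).le two_ne_zero)
  have hk : 0 < (k : ℝ)⁻¹ := inv_pos.mpr (Nat.cast_pos.mpr (linkKey π x).1.pos)
  rcases x with p | p
  · exact mul_neg_of_pos_of_neg (mul_pos (mul_pos two_pos hk) (pow_pos (hb _) 2)) hsq
  · have := sub_pos.mpr (pow_lt_pow_left₀ (hb' p.2) (hb _).le two_ne_zero)
    exact mul_neg_of_pos_of_neg (mul_pos (mul_pos two_pos hk) this) hsq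

end General

/-! ## The complex structure -/

section ComplexStructure

variable {n k : ℕ}

theorem inner_complexStr_left (x y : EuclideanSpace ℝ (Fin n ⊕ Fin n)) :
    (inner ℝ (complexStr n x) y : ℝ) = -inner ℝ x (complexStr n y) := by
  have h := inner_transpose_toEuclideanLin (Matrix.J (Fin n) ℝ) x y
  rw [Matrix.J_transpose, map_neg, LinearMap.neg_apply, inner_neg_left] at h
  rw [complexStr, ← h, neg_neg]

theorem complexStr_complexStr (x : EuclideanSpace ℝ (Fin n ⊕ Fin n)) :
    complexStr n (complexStr n x) = -x := by
  rw [complexStr, ← toEuclideanLin_mul, Matrix.J_squared, map_neg]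
  simp [Matrix.toLpLin_one]

theorem inner_complexStr_complexStr (x y : EuclideanSpace ℝ (Fin n ⊕ Fin n)) :
    (inner ℝ (complexStr n x) (complexStr n y) : ℝ) = inner ℝ x y := by
  rw [inner_complexStr_left, complexStr_complexStr, inner_neg_right, neg_neg]

theorem inner_complexStr_comm (x y : EuclideanSpace ℝ (Fin n ⊕ Fin n)) :
    (inner ℝ y (complexStr n x) : ℝ) = -inner ℝ x (complexStr n y) := by
  rw [real_inner_comm, inner_complexStr_left]

theorem inner_complexStr_self (x : EuclideanSpace ℝ (Fin n ⊕ Fin n)) :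
    (inner ℝ x (complexStr n x) : ℝ) = 0 := by
  have := inner_complexStr_comm x x
  linarith

/-- The symplectic form `⟨x, J y⟩`. -/
def sympForm (n : ℕ) : EuclideanSpace ℝ (Fin n ⊕ Fin n) →ₗ[ℝ]
    EuclideanSpace ℝ (Fin n ⊕ Fin n) →ₗ[ℝ] ℝ :=
  (innerₗ _).compl₂ (complexStr n)

theorem sympForm_apply (x y : EuclideanSpace ℝ (Fin n ⊕ Fin n)) :
    sympForm n x y = inner ℝ x (complexStr n y) := rfl

theorem IsFrame.mem_isotropicFlags_iff {X : Fin k → EuclideanSpace ℝ (Fin n ⊕ Fin n)}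
    {V : KFlag (Fin n ⊕ Fin n) k} (h : IsFrame X V) :
    V ∈ isotropicFlags n k ↔ ∀ i j, (inner ℝ (X i) (complexStr n (X j)) : ℝ) = 0 := by
  constructor
  · intro hV i j
    exact hV (max i j) _ (V.mono (le_max_left i j) (h.mem_line i).1) _
      (V.mono (le_max_right i j) (h.mem_line j).1)
  · intro hX i x hx y hy
    rw [h.2 i] at hx hy
    induction hx using Submodule.span_induction with
    | mem x hx =>
      obtain ⟨s, -, rfl⟩ := hx
      induction hy using Submodule.span_induction with
      | mem y hy =>
        obtain ⟨r, -, rfl⟩ := hy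
        exact hX s r
      | zero => simp
      | add x y _ _ hx hy => rw [map_add, inner_add_right, hx, hy, add_zero]
      | smul c x _ hx => rw [map_smul, inner_smul_right, hx, mul_zero]
    | zero => simp
    | add x y _ _ hx hy => rw [inner_add_left, hx, hy, add_zero]
    | smul c x _ hx => rw [inner_smul_left, hx, mul_zero]

theorem ofFrame_mem_isotropicFlags {X : Fin k → EuclideanSpace ℝ (Fin n ⊕ Fin n)}
    (hX : Orthonormal ℝ X) (h : ∀ i j, (inner ℝ (X i) (complexStr n (X j)) : ℝ) = 0) :
    ofFrame X hX ∈ isotropicFlags n k :=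
  (isFrame_ofFrame X hX).mem_isotropicFlags_iff.mpr h

/-- The derivatives of curves of isotropic orthonormal frames. -/
def isoSpace (e : Fin k → EuclideanSpace ℝ (Fin n ⊕ Fin n)) :
    Submodule ℝ (Fin k → EuclideanSpace ℝ (Fin n ⊕ Fin n)) where
  carrier := {Y | Y ∈ skewSpace e ∧ Infinitesimal (sympForm n) e Y}
  zero_mem' := ⟨Submodule.zero_mem _, fun i j => by simp⟩
  add_mem' {Y Z} hY hZ := by
    refine ⟨Submodule.add_mem _ hY.1 hZ.1, fun i j => ?_⟩
    have h1 := hY.2 i j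
    have h2 := hZ.2 i j
    simp only [Pi.add_apply, map_add, LinearMap.add_apply]
    linarith
  smul_mem' c Y hY := by
    refine ⟨Submodule.smul_mem _ c hY.1, fun i j => ?_⟩
    have h1 := hY.2 i j
    simp only [Pi.smul_apply, map_smul, LinearMap.smul_apply]
    rw [← smul_add, h1, smul_zero]

/-- Isotropy makes the family `(e, Je)` orthonormal, and the two conditions in `isoSpace` are what
`exists_skew` needs to send it to `(Y, JY)`. -/
theorem exists_skew_commuting {e Y : Fin k → EuclideanSpace ℝ (Fin n ⊕ Fin n)}
    (he : Orthonormal ℝ e) (hiso : ∀ i j, (inner ℝ (e i) (complexStr n (e j)) : ℝ) = 0)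
    (hY : Y ∈ isoSpace e) :
    ∃ Z : EuclideanSpace ℝ (Fin n ⊕ Fin n) →L[ℝ] EuclideanSpace ℝ (Fin n ⊕ Fin n),
      (∀ x y, (inner ℝ (Z x) y : ℝ) = -inner ℝ x (Z y)) ∧
      (∀ x, Z (complexStr n x) = complexStr n (Z x)) ∧ ∀ i, Z (e i) = Y i := by
  have hee := orthonormal_iff_ite.mp he
  have hsk : ∀ i j, (inner ℝ (Y i) (e j) + inner ℝ (e i) (Y j) : ℝ) = 0 := hY.1
  have hsy : ∀ i j, (inner ℝ (Y i) (complexStr n (e j)) +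
    inner ℝ (e i) (complexStr n (Y j)) : ℝ) = 0 := hY.2
  have ho : Orthonormal ℝ (Sum.elim e fun i => complexStr n (e i)) := by
    rw [orthonormal_iff_ite]
    rintro (i | i) (j | j)
    · simp [hee]
    · simp [hiso]
    · simp [inner_complexStr_left, hiso]
    · simp [inner_complexStr_complexStr, hee]
  obtain ⟨Z, hZ, hZe⟩ := exists_skew (Y := Sum.elim Y fun i => complexStr n (Y i)) ho (by
    rintro (i | i) (j | j)
    · exact hsk i j
    · exact hsy i j
    · have := hsy i j
      simp only [Sum.elim_inl, Sum.elim_inr, inner_complexStr_left]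
      linarith
    · simpa only [Sum.elim_inr, inner_complexStr_complexStr] using hsk i j)
  let Jc := (complexStr n).toContinuousLinearMap
  -- Averaging `Z` with its conjugate `-JZJ` gives a map commuting with `J`; it stays skew and keeps
  -- the values at `e i`, since `Z (J e_i) = J Y_i`.
  refine ⟨(2⁻¹ : ℝ) • (Z - Jc ∘L Z ∘L Jc), fun x y => ?_, fun x => ?_, fun i => ?_⟩
  · simp [Jc, inner_sub_left, inner_sub_right, real_inner_smul_left, real_inner_smul_right,
      inner_complexStr_left, hZ]
    ring
  · simp [Jc, complexStr_complexStr]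
    abel
  · have h1 := hZe (.inl i)
    have h2 := hZe (.inr i)
    simp only [Sum.elim_inl, Sum.elim_inr] at h1 h2
    simp only [Jc, _root_.smul_apply, _root_.sub_apply, ContinuousLinearMap.comp_apply,
      LinearMap.coe_toContinuousLinearMap', h1, h2, complexStr_complexStr, sub_neg_eq_add]
    rw [← two_smul ℝ, smul_smul, inv_mul_cancel₀ two_ne_zero, one_smul]

theorem exp_complexStr {Z : EuclideanSpace ℝ (Fin n ⊕ Fin n) →L[ℝ] EuclideanSpace ℝ (Fin n ⊕ Fin n)}
    (hZ : ∀ x, Z (complexStr n x) = complexStr n (Z x)) (t : ℝ)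
    (x : EuclideanSpace ℝ (Fin n ⊕ Fin n)) :
    NormedSpace.exp (t • Z) (complexStr n x) = complexStr n (NormedSpace.exp (t • Z) x) := by
  let Jc := (complexStr n).toContinuousLinearMap
  have h : Commute Jc (t • Z) := by
    ext1 x
    simp [Jc, hZ]
  let _ := NormedAlgebra.restrictScalars ℚ ℝ
    (EuclideanSpace ℝ (Fin n ⊕ Fin n) →L[ℝ] EuclideanSpace ℝ (Fin n ⊕ Fin n))
  exact (DFunLike.congr_fun h.exp_right x).symm

/-- An isometry between lines is a sign on unit vectors. Applying `J` again and using `J² = -1`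
gives the opposite sign on the conjugate vectors. -/
theorem exists_complexStr_basis
    {u : OrthonormalBasis (Fin n ⊕ Fin n) ℝ (EuclideanSpace ℝ (Fin n ⊕ Fin n))}
    (h : ∀ a : Fin n, (Submodule.span ℝ {u (Sum.inl a)}).map (complexStr n) =
      Submodule.span ℝ {u (Sum.inr a)}) :
    ∃ ε : Fin n ⊕ Fin n → ℝ, (∀ a, ε a * ε a = 1) ∧ ∀ a, complexStr n (u a) = ε a • u a.swap := by
  have key : ∀ a : Fin n, ∃ c : ℝ, c * c = 1 ∧ complexStr n (u (.inl a)) = c • u (.inr a) := by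
    intro a
    have h1 : complexStr n (u (.inl a)) ∈ Submodule.span ℝ {u (Sum.inr a)} := by
      rw [← h a]
      exact Submodule.mem_map_of_mem (Submodule.mem_span_singleton_self _)
    obtain ⟨c, hc⟩ := Submodule.mem_span_singleton.mp h1
    refine ⟨c, ?_, hc.symm⟩
    have h2 := inner_complexStr_complexStr (u (.inl a)) (u (.inl a))
    rw [← hc, real_inner_smul_left, real_inner_smul_right, u.inner_eq_one, u.inner_eq_one,
      mul_one] at h2
    exact h2
  choose c hc hcu using key
  refine ⟨Sum.elim c fun a => -c a, ?_, ?_⟩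
  · rintro (a | a) <;> simp [hc]
  · rintro (a | a)
    · exact hcu a
    · have h1 := congrArg (complexStr n) (hcu a)
      rw [complexStr_complexStr, map_smul] at h1
      have h2 := congrArg (fun v => c a • v) h1
      simp only [smul_smul, hc, one_smul] at h2
      rw [← h2]
      simp

/-- Evaluate `AᵗJA = J` on `u a` and pair the result with `u a.swap`. -/
theorem eigenvalue_mul_swap {A : Matrix (Fin n ⊕ Fin n) (Fin n ⊕ Fin n) ℝ}
    {u : OrthonormalBasis (Fin n ⊕ Fin n) ℝ (EuclideanSpace ℝ (Fin n ⊕ Fin n))}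
    {ε lam : Fin n ⊕ Fin n → ℝ} (hε : ∀ a, ε a * ε a = 1)
    (hJ : ∀ a, complexStr n (u a) = ε a • u a.swap)
    (hA : A ∈ Matrix.symplecticGroup (Fin n) ℝ)
    (h : ∀ a, A.toEuclideanLin (u a) = lam a • u a) (a : Fin n ⊕ Fin n) :
    lam a * lam a.swap = 1 := by
  have h1 := congrArg (fun M => (inner ℝ (M.toEuclideanLin (u a)) (u a.swap) : ℝ))
    (SymplecticGroup.mem_iff'.mp hA)
  have hJ' : (Matrix.J (Fin n) ℝ).toEuclideanLin (u a) = ε a • u a.swap := hJ a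
  simp only [toEuclideanLin_mul, inner_transpose_toEuclideanLin, h, hJ', map_smul,
    real_inner_smul_left, real_inner_smul_right, u.inner_eq_one] at h1
  have h0 : ε a ≠ 0 := fun h0 => by simpa [h0] using hε a
  apply mul_left_cancel₀ h0
  linear_combination h1

end ComplexStructure

/-! ## The isotropic flag manifold -/

section Symplectic

variable {n k : ℕ} (u : OrthonormalBasis (Fin n ⊕ Fin n) ℝ (EuclideanSpace ℝ (Fin n ⊕ Fin n)))
  (π : Fin k ↪ Fin n ⊕ Fin n)

theorem IsIsotropic.swap_ne {π : Fin k ↪ Fin n ⊕ Fin n} (hπ : IsIsotropic π) (i j : Fin k) :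
    (π i).swap ≠ π j := by
  intro h
  have h1 : i = j := hπ (by
    simp only [← h]
    cases π i <;> rfl)
  subst h1
  cases h2 : π i <;> simp [h2] at h

/-- The index of the line that is moved, and the direction in which it is moved. -/
def spLinkKey : SpLink π → Fin k × (Fin n ⊕ Fin n)
  | .inl (.inl i) => (i, (π i).swap)
  | .inl (.inr p) => p.1
  | .inr (.inl p) => (p.1.1, π p.1.2)
  | .inr (.inr p) => (p.1.1, (π p.1.2).swap)

/-- The direction in which the line is moved. -/
def spLinkVec : SpLink π → EuclideanSpace ℝ (Fin n ⊕ Fin n)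
  | .inl (.inl i) => u (π i).swap
  | .inl (.inr p) => u p.1.2
  | .inr (.inl p) => u (π p.1.2)
  | .inr (.inr p) => complexStr n (u (π p.1.2))

/-- The derivative of `spLinkFrame`. -/
def spLinkDir : SpLink π → Fin k → EuclideanSpace ℝ (Fin n ⊕ Fin n)
  | .inl (.inl i) => Pi.single i (u (π i).swap)
  | .inl (.inr p) => Pi.single p.1.1 (u p.1.2)
  | .inr (.inl p) => Pi.single p.1.1 (u (π p.1.2)) + Pi.single p.1.2 (-u (π p.1.1))
  | .inr (.inr p) => Pi.single p.1.1 (complexStr n (u (π p.1.2))) +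
      Pi.single p.1.2 (complexStr n (u (π p.1.1)))

/-- Coordinates dual to `spLinkDir`. -/
def spLinkCoord : (Fin k → EuclideanSpace ℝ (Fin n ⊕ Fin n)) →ₗ[ℝ] (SpLink π → ℝ) :=
  LinearMap.pi fun x => innerₗ _ (spLinkVec u π x) ∘ₗ LinearMap.proj (spLinkKey π x).1

theorem spLinkCoord_apply (Y : Fin k → EuclideanSpace ℝ (Fin n ⊕ Fin n)) (x : SpLink π) :
    spLinkCoord u π Y x = inner ℝ (spLinkVec u π x) (Y (spLinkKey π x).1) := rfl

theorem complexStr_ne_zero {x : EuclideanSpace ℝ (Fin n ⊕ Fin n)} (hx : x ≠ 0) :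
    complexStr n x ≠ 0 := by
  intro h
  have := complexStr_complexStr x
  rw [h, map_zero, eq_comm, neg_eq_zero] at this
  exact hx this

theorem spLinkFrame_eq_rot (x : SpLink π) :
    spLinkFrame u π x = rot (fun i => u (π i)) (spLinkDir u π x) := by
  funext t
  have hu := u.orthonormal.ne_zero
  rcases x with (i | p) | (p | p)
  · exact update_eq_rot_single (e := fun i => u (π i)) (hu _) t
  · exact update_eq_rot_single (e := fun i => u (π i)) (hu _) t
  · rw [spLinkDir, ← update_update_eq_rot p.2.ne (hu _) (neg_ne_zero.mpr (hu _)), smul_neg,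
      ← sub_eq_add_neg]
    rfl
  · exact update_update_eq_rot (e := fun i => u (π i)) p.2.ne (complexStr_ne_zero (hu _))
      (complexStr_ne_zero (hu _)) t

theorem mem_spLinkSets_inl_inl (j : Fin k) (i : Fin k) (a : Fin n ⊕ Fin n) :
    a ∈ spLinkSets π (.inl (.inl j)) i ↔ a = π i ∨ i = j ∧ a = (π j).swap := by
  simp only [spLinkSets, Function.update_apply]
  split_ifs with h <;> simp [h]

theorem mem_spLinkSets_inl_inr
    (p : {p : Fin k × (Fin n ⊕ Fin n) // p.2 ∉ Set.range π ∧ p.2.swap ∉ Set.range π})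
    (i : Fin k) (a : Fin n ⊕ Fin n) :
    a ∈ spLinkSets π (.inl (.inr p)) i ↔ a = π i ∨ i = p.1.1 ∧ a = p.1.2 := by
  simp only [spLinkSets, Function.update_apply]
  split_ifs with h <;> simp [h]

theorem mem_spLinkSets_inr_inl (p : {p : Fin k × Fin k // p.1 < p.2}) (i : Fin k)
    (a : Fin n ⊕ Fin n) :
    a ∈ spLinkSets π (.inr (.inl p)) i ↔
      a = π i ∨ i = p.1.1 ∧ a = π p.1.2 ∨ i = p.1.2 ∧ a = π p.1.1 := by
  have := p.2.ne
  simp only [spLinkSets, Function.update_apply]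
  split_ifs with h h'
  · simp [h, this.symm, or_comm]
  · simp [h', this]
  · simp [h, h']

theorem mem_spLinkSets_inr_inr (p : {p : Fin k × Fin k // p.1 < p.2}) (i : Fin k)
    (a : Fin n ⊕ Fin n) :
    a ∈ spLinkSets π (.inr (.inr p)) i ↔
      a = π i ∨ i = p.1.1 ∧ a = (π p.1.2).swap ∨ i = p.1.2 ∧ a = (π p.1.1).swap := by
  have := p.2.ne
  simp only [spLinkSets, Function.update_apply]
  split_ifs with h h'
  · simp [h, this.symm]
  · simp [h', this]
  · simp [h, h']

theorem self_mem_spLinkSets (x : SpLink π) (i : Fin k) : π i ∈ spLinkSets π x i := by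
  rcases x with (j | p) | (p | p)
  · exact (mem_spLinkSets_inl_inl π j i _).mpr (Or.inl rfl)
  · exact (mem_spLinkSets_inl_inr π p i _).mpr (Or.inl rfl)
  · exact (mem_spLinkSets_inr_inl π p i _).mpr (Or.inl rfl)
  · exact (mem_spLinkSets_inr_inr π p i _).mpr (Or.inl rfl)

theorem swap_injective : Function.Injective (Sum.swap : Fin n ⊕ Fin n → Fin n ⊕ Fin n) :=
  Function.LeftInverse.injective Sum.swap_swap

variable {π} in
-- The entries of `π`, their conjugates and the remaining indices are three disjoint classes. Only
-- coincidences within a class survive the simplification, and they contradict `z ≠ x` or the order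
-- in the pairs.
theorem spLinkKey_notMem (hπ : IsIsotropic π) {x z : SpLink π} (h : z ≠ x) :
    (spLinkKey π z).2 ∉ spLinkSets π x (spLinkKey π z).1 := by
  have hsw := hπ.swap_ne
  have hsw' : ∀ i j, π j ≠ (π i).swap := fun i j => (hsw i j).symm
  have hss : ∀ i j, (π i).swap = (π j).swap ↔ i = j := fun i j =>
    (swap_injective.comp π.injective).eq_iff
  have hp : ∀ (p : {p : Fin k × (Fin n ⊕ Fin n) // p.2 ∉ Set.range π ∧ p.2.swap ∉ Set.range π})
      (i : Fin k), p.1.2 ≠ π i ∧ p.1.2 ≠ (π i).swap := fun p i =>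
    ⟨fun h => p.2.1 ⟨i, h.symm⟩, fun h => p.2.2 ⟨i, by rw [h, Sum.swap_swap]⟩⟩
  have hp' : ∀ (p : {p : Fin k × (Fin n ⊕ Fin n) // p.2 ∉ Set.range π ∧ p.2.swap ∉ Set.range π})
      (i : Fin k), π i ≠ p.1.2 ∧ (π i).swap ≠ p.1.2 := fun p i =>
    ⟨(hp p i).1.symm, (hp p i).2.symm⟩
  have hlt : ∀ p q : {p : Fin k × Fin k // p.1 < p.2}, p.1.1 = q.1.2 → p.1.2 = q.1.1 → False :=
    fun p q h1 h2 => by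
      have h3 := p.2
      rw [h1, h2] at h3
      exact lt_asymm h3 q.2
  rcases x with (i | p) | (p | p) <;> rcases z with (j | q) | (q | q) <;>
    simp only [mem_spLinkSets_inl_inl, mem_spLinkSets_inl_inr, mem_spLinkSets_inr_inl,
      mem_spLinkSets_inr_inr, spLinkKey, EmbeddingLike.apply_eq_iff_eq, hss, hsw, hsw', hp, hp',
      and_false, or_false, false_or, not_false_eq_true, ne_eq, not_or, not_and]
  · exact fun h1 _ => h (by rw [h1])
  · exact q.2.ne'
  · exact fun h1 h2 => q.2.ne (h1.trans h2.symm)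
  · exact fun h1 h2 => h (by rw [Subtype.ext (Prod.ext h1 h2)])
  · exact q.2.ne'
  · exact ⟨q.2.ne', fun h1 h2 => h (by rw [Subtype.ext (Prod.ext h1 h2)]), fun h1 h2 => hlt q p h1 h2⟩
  · exact ⟨fun h1 h2 => p.2.ne (h1.symm.trans h2), fun h1 h2 => p.2.ne (h2.symm.trans h1)⟩
  · exact q.2.ne'
  · exact ⟨fun h1 h2 => h (by rw [Subtype.ext (Prod.ext h1 h2)]), fun h1 h2 => hlt q p h1 h2⟩

variable {π} in
theorem spLinkKey_ne (hπ : IsIsotropic π) (x : SpLink π) :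
    (spLinkKey π x).2 ≠ π (spLinkKey π x).1 := by
  rcases x with (j | p) | (p | p)
  · exact hπ.swap_ne _ _
  · exact fun h => p.2.1 ⟨_, h.symm⟩
  · exact fun h => p.2.ne' (π.injective h)
  · exact hπ.swap_ne _ _

variable {ε : Fin n ⊕ Fin n → ℝ}

theorem spLinkDir_mem_span (hJ : ∀ a, complexStr n (u a) = ε a • u a.swap) (x : SpLink π)
    (i : Fin k) : spLinkDir u π x i ∈ Submodule.span ℝ (u '' spLinkSets π x i) := by
  have hu : ∀ a, a ∈ spLinkSets π x i → u a ∈ Submodule.span ℝ (u '' spLinkSets π x i) :=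
    fun a ha => Submodule.subset_span ⟨a, ha, rfl⟩
  rcases x with (j | p) | (p | p)
  · rw [spLinkDir, Pi.single_apply]
    split_ifs with h
    · exact hu _ ((mem_spLinkSets_inl_inl π j i _).mpr (Or.inr ⟨h, rfl⟩))
    · exact Submodule.zero_mem _
  · rw [spLinkDir, Pi.single_apply]
    split_ifs with h
    · exact hu _ ((mem_spLinkSets_inl_inr π p i _).mpr (Or.inr ⟨h, rfl⟩))
    · exact Submodule.zero_mem _
  · rw [spLinkDir, Pi.add_apply, Pi.single_apply, Pi.single_apply]
    refine Submodule.add_mem _ ?_ ?_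
    · split_ifs with h
      · exact hu _ ((mem_spLinkSets_inr_inl π p i _).mpr (Or.inr (Or.inl ⟨h, rfl⟩)))
      · exact Submodule.zero_mem _
    · split_ifs with h
      · exact Submodule.neg_mem _
          (hu _ ((mem_spLinkSets_inr_inl π p i _).mpr (Or.inr (Or.inr ⟨h, rfl⟩))))
      · exact Submodule.zero_mem _
  · rw [spLinkDir, Pi.add_apply, Pi.single_apply, Pi.single_apply, hJ, hJ]
    refine Submodule.add_mem _ ?_ ?_
    · split_ifs with h
      · exact Submodule.smul_mem _ _
          (hu _ ((mem_spLinkSets_inr_inr π p i _).mpr (Or.inr (Or.inl ⟨h, rfl⟩))))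
      · exact Submodule.zero_mem _
    · split_ifs with h
      · exact Submodule.smul_mem _ _
          (hu _ ((mem_spLinkSets_inr_inr π p i _).mpr (Or.inr (Or.inr ⟨h, rfl⟩))))
      · exact Submodule.zero_mem _

variable {π} in
theorem inner_complexStr_coord (hπ : IsIsotropic π) (hJ : ∀ a, complexStr n (u a) = ε a • u a.swap)
    (i j : Fin k) : (inner ℝ (u (π i)) (complexStr n (u (π j))) : ℝ) = 0 := by
  rw [hJ, real_inner_smul_right, u.inner_eq_zero (hπ.swap_ne j i).symm, mul_zero]

variable {π} in
theorem spLinkDir_orthonormal (hπ : IsIsotropic π)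
    (hJ : ∀ a, complexStr n (u a) = ε a • u a.swap) (x : SpLink π) :
    Infinitesimal (innerₗ (EuclideanSpace ℝ (Fin n ⊕ Fin n))) (fun i => u (π i))
      (spLinkDir u π x) ∧
    ∀ i j, spLinkDir u π x i ≠ 0 → spLinkDir u π x j ≠ 0 →
      innerₗ (EuclideanSpace ℝ (Fin n ⊕ Fin n)) (spLinkDir u π x i) (spLinkDir u π x j) =
        innerₗ (EuclideanSpace ℝ (Fin n ⊕ Fin n)) (u (π i)) (u (π j)) := by
  have hβ : ∀ x y, innerₗ (EuclideanSpace ℝ (Fin n ⊕ Fin n)) y x = 1 * innerₗ _ x y := fun x y => by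
    rw [one_mul]
    exact real_inner_comm x y
  have hs : ∀ (c : Fin n ⊕ Fin n) (i : Fin k), (∀ b, c ≠ π b) →
      Infinitesimal (innerₗ (EuclideanSpace ℝ (Fin n ⊕ Fin n))) (fun i => u (π i))
        (Pi.single i (u c)) := by
    intro c i hc
    have h : ∀ b, innerₗ (EuclideanSpace ℝ (Fin n ⊕ Fin n)) (u c) (u (π b)) = 0 := fun b =>
      u.inner_eq_zero (hc b)
    refine infinitesimal_single hβ (fun b _ => h b) ?_
    rw [hβ (u c) (u (π i)), h, mul_zero, add_zero]
  rcases x with (i | p) | (p | p)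
  · exact ⟨hs _ _ (hπ.swap_ne i), single_pairing (e := fun i => u (π i)) (by simp)⟩
  · exact ⟨hs _ _ fun b h => p.2.1 ⟨b, h.symm⟩, single_pairing (e := fun i => u (π i)) (by simp)⟩
  · have hne := p.2.ne
    refine ⟨infinitesimal_add_single hβ hne (fun b hb => ?_) (fun b hb => ?_) ?_,
      add_single_pairing (e := fun i => u (π i)) hβ hne ?_ ?_ ?_⟩
    · simp [innerₗ_apply_apply, u.inner_eq_ite, hb.symm]
    · simp [innerₗ_apply_apply, u.inner_eq_ite, hb.symm]
    · simp [innerₗ_apply_apply]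
    · simp [innerₗ_apply_apply]
    · simp [innerₗ_apply_apply]
    · simp [innerₗ_apply_apply, u.inner_eq_ite, hne, hne.symm]
  · have hne := p.2.ne
    have h0 := inner_complexStr_coord u hπ hJ
    refine ⟨infinitesimal_add_single hβ hne (fun b _ => ?_) (fun b _ => ?_) ?_,
      add_single_pairing (e := fun i => u (π i)) hβ hne ?_ ?_ ?_⟩
    · rw [innerₗ_apply_apply, inner_complexStr_left, h0, neg_zero]
    · rw [innerₗ_apply_apply, inner_complexStr_left, h0, neg_zero]
    · rw [innerₗ_apply_apply, innerₗ_apply_apply, inner_complexStr_self, real_inner_comm,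
        inner_complexStr_self, add_zero]
    · rw [innerₗ_apply_apply, inner_complexStr_complexStr, innerₗ_apply_apply, u.inner_eq_one,
        u.inner_eq_one]
    · rw [innerₗ_apply_apply, inner_complexStr_complexStr, innerₗ_apply_apply, u.inner_eq_one,
        u.inner_eq_one]
    · simp [innerₗ_apply_apply, inner_complexStr_complexStr, u.inner_eq_ite, hne, hne.symm]

variable {π} in
theorem spLinkDir_isotropic (hπ : IsIsotropic π)
    (hJ : ∀ a, complexStr n (u a) = ε a • u a.swap) (x : SpLink π) :
    Infinitesimal (sympForm n) (fun i => u (π i)) (spLinkDir u π x) ∧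
    ∀ i j, spLinkDir u π x i ≠ 0 → spLinkDir u π x j ≠ 0 →
      sympForm n (spLinkDir u π x i) (spLinkDir u π x j) = sympForm n (u (π i)) (u (π j)) := by
  have hβ : ∀ x y, sympForm n y x = -1 * sympForm n x y := fun x y => by
    rw [neg_one_mul]
    exact inner_complexStr_comm x y
  have h0 := inner_complexStr_coord u hπ hJ
  have hs : ∀ (c : Fin n ⊕ Fin n) (i : Fin k), (∀ b, b ≠ i → c ≠ (π b).swap) →
      Infinitesimal (sympForm n) (fun i => u (π i)) (Pi.single i (u c)) := by
    intro c i hc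
    refine infinitesimal_single hβ (fun b hb => ?_) ?_
    · rw [sympForm_apply, hJ, real_inner_smul_right, u.inner_eq_zero (hc b hb), mul_zero]
    · rw [hβ (u c) (u (π i)), neg_one_mul, add_neg_cancel]
  have hself : ∀ x y, sympForm n x x = sympForm n y y := fun x y => by
    rw [sympForm_apply, sympForm_apply, inner_complexStr_self, inner_complexStr_self]
  rcases x with (i | p) | (p | p)
  · exact ⟨hs _ _ fun b hb h => hb (π.injective (swap_injective h)).symm,
      single_pairing (e := fun i => u (π i)) (hself _ _)⟩
  · exact ⟨hs _ _ fun b _ h => p.2.2 ⟨b, by rw [h, Sum.swap_swap]⟩,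
      single_pairing (e := fun i => u (π i)) (hself _ _)⟩
  · have hne := p.2.ne
    refine ⟨infinitesimal_add_single hβ hne (fun b _ => ?_) (fun b _ => ?_) ?_,
      add_single_pairing (e := fun i => u (π i)) hβ hne (hself _ _) (hself _ _) ?_⟩
    · exact h0 _ _
    · rw [map_neg, LinearMap.neg_apply, sympForm_apply, h0, neg_zero]
    · rw [map_neg, sympForm_apply, sympForm_apply, h0, h0, neg_zero, add_zero]
    · rw [map_neg, sympForm_apply, sympForm_apply, h0, h0, neg_zero]
  · have hne := p.2.ne
    have hee : ∀ i j, i ≠ j → (inner ℝ (u (π i)) (u (π j)) : ℝ) = 0 := fun i j h =>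
      u.inner_eq_zero (π.injective.ne h)
    refine ⟨infinitesimal_add_single hβ hne (fun b hb => ?_) (fun b hb => ?_) ?_,
      add_single_pairing (e := fun i => u (π i)) hβ hne (hself _ _) (hself _ _) ?_⟩
    · rw [sympForm_apply, inner_complexStr_complexStr, hee _ _ hb.symm]
    · rw [sympForm_apply, inner_complexStr_complexStr, hee _ _ hb.symm]
    -- The contributions are `⟨Ju, Ju⟩ = 1` and `⟨u, JJu⟩ = -1`. Their cancellation is the reason
    -- for the two plus signs in the last family of `spLinkFrame`.
    · rw [sympForm_apply, sympForm_apply, inner_complexStr_complexStr, complexStr_complexStr,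
        inner_neg_right, u.inner_eq_one, u.inner_eq_one, add_neg_cancel]
    · rw [sympForm_apply, sympForm_apply, inner_complexStr_complexStr, h0, real_inner_comm,
        inner_complexStr_left, h0, neg_zero]

variable {π} in
theorem spLinkFrame_orthonormal (hπ : IsIsotropic π)
    (hJ : ∀ a, complexStr n (u a) = ε a • u a.swap) (x : SpLink π) (t : ℝ) :
    Orthonormal ℝ (spLinkFrame u π x t) := by
  rw [spLinkFrame_eq_rot]
  exact orthonormal_rot (u.orthonormal.comp π π.injective) (spLinkDir_orthonormal u hπ hJ x).1
    (spLinkDir_orthonormal u hπ hJ x).2 t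

variable {π} in
theorem spLinkFrame_isotropic (hπ : IsIsotropic π)
    (hJ : ∀ a, complexStr n (u a) = ε a • u a.swap) (x : SpLink π) (t : ℝ) (i j : Fin k) :
    (inner ℝ (spLinkFrame u π x t i) (complexStr n (spLinkFrame u π x t j)) : ℝ) = 0 := by
  rw [spLinkFrame_eq_rot]
  have h0 := inner_complexStr_coord u hπ hJ
  exact (rot_preserves (spLinkDir_isotropic u hπ hJ x).1 (fun i j _ => h0 i j)
    (spLinkDir_isotropic u hπ hJ x).2 t i j).trans (h0 i j)

variable {π} in
theorem spLinkVec_eq (hε : ∀ a, ε a * ε a = 1) (hJ : ∀ a, complexStr n (u a) = ε a • u a.swap)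
    (x : SpLink π) : ∃ c : ℝ, c * c = 1 ∧ spLinkVec u π x = c • u (spLinkKey π x).2 := by
  rcases x with (i | p) | (p | p)
  · exact ⟨1, one_mul 1, (one_smul _ _).symm⟩
  · exact ⟨1, one_mul 1, (one_smul _ _).symm⟩
  · exact ⟨1, one_mul 1, (one_smul _ _).symm⟩
  · exact ⟨ε (π p.1.2), hε _, hJ _⟩

theorem spLinkDir_key (x : SpLink π) : spLinkDir u π x (spLinkKey π x).1 = spLinkVec u π x := by
  rcases x with (i | p) | (p | p)
  · simp [spLinkDir, spLinkKey, spLinkVec]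
  · simp [spLinkDir, spLinkKey, spLinkVec]
  · simp [spLinkDir, spLinkKey, spLinkVec, p.2.ne]
  · simp [spLinkDir, spLinkKey, spLinkVec, p.2.ne]

variable {π} in
-- Components along entries of `π` are handled by skewness, those along conjugates by the symplectic
-- relation; in both cases `i > j` reduces to `j < i`. The other components are coordinates
-- themselves.
theorem spLinkCoord_injective (hε : ∀ a, ε a * ε a = 1)
    (hJ : ∀ a, complexStr n (u a) = ε a • u a.swap) {Y : Fin k → EuclideanSpace ℝ (Fin n ⊕ Fin n)}
    (hY : Y ∈ isoSpace fun i => u (π i)) (h : spLinkCoord u π Y = 0) : Y = 0 := by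
  have hsk : ∀ i j, (inner ℝ (Y i) (u (π j)) + inner ℝ (u (π i)) (Y j) : ℝ) = 0 := hY.1
  have hsy : ∀ i j, (inner ℝ (Y i) (complexStr n (u (π j))) +
    inner ℝ (u (π i)) (complexStr n (Y j)) : ℝ) = 0 := hY.2
  have hlt : ∀ i j, i < j → (inner ℝ (u (π j)) (Y i) : ℝ) = 0 := fun i j hij =>
    congrFun h (.inr (.inl ⟨(i, j), hij⟩))
  have hlt' : ∀ i j, i < j → (inner ℝ (complexStr n (u (π j))) (Y i) : ℝ) = 0 := fun i j hij =>
    congrFun h (.inr (.inr ⟨(i, j), hij⟩))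
  funext i
  apply u.repr.injective
  ext a
  rw [u.repr_apply_apply, Pi.zero_apply, map_zero]
  by_cases ha : a ∈ Set.range π
  · obtain ⟨j, rfl⟩ := ha
    have h1 := hsk i j
    rw [real_inner_comm] at h1
    rcases lt_trichotomy i j with hij | rfl | hij
    · exact hlt i j hij
    · change (inner ℝ (u (π i)) (Y i) : ℝ) = 0
      linarith
    · rw [hlt j i hij, add_zero] at h1
      exact h1
  · by_cases ha' : a.swap ∈ Set.range π
    · obtain ⟨j, hj⟩ := ha'
      obtain rfl : a = (π j).swap := by rw [hj, Sum.swap_swap]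
      have key : (inner ℝ (complexStr n (u (π j))) (Y i) : ℝ) = 0 →
          (inner ℝ (u (π j).swap) (Y i) : ℝ) = 0 := fun h0 => by
        rw [hJ, real_inner_smul_left] at h0
        exact (mul_eq_zero.mp h0).resolve_left fun h' => by simpa [h'] using hε (π j)
      rcases lt_trichotomy i j with hij | rfl | hij
      · exact key (hlt' i j hij)
      · exact congrFun h (.inl (.inl i))
      · have h1 := hsy i j
        have h2 := hlt' j i hij
        rw [inner_complexStr_left] at h2
        rw [neg_eq_zero.mp h2, add_zero, real_inner_comm] at h1
        exact key h1
    · exact congrFun h (.inl (.inr ⟨(i, a), ha, ha'⟩))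

/-- The one-dimensional strata through `V_π` in the manifold of isotropic flags. -/
def spLinkSystem (hπ : IsIsotropic π) (hε : ∀ a, ε a * ε a = 1)
    (hJ : ∀ a, complexStr n (u a) = ε a • u a.swap) :
    StratumSystem (SpLink π) u π (isotropicFlags n k)
      (fun x => stratum u (spLinkSets π x) ∩ isotropicFlags n k) (spLinkFrame u π) where
  K := isoSpace fun i => u (π i)
  K_le _ hY := hY.1
  mem_K γ X Y hγ hX0 hX hY := by
    rw [← hX0]
    refine ⟨mem_skewSpace_of_hasDerivAt hY (hX.mono fun t ht => ht.1), fun i j => ?_⟩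
    let Jc := (complexStr n).toContinuousLinearMap
    have hY' := hasDerivAt_pi.mp hY
    -- Differentiate the isotropy relation `⟨X_i, J X_j⟩ = 0`.
    have h1 := (hY' i).inner ℝ (Jc.hasFDerivAt.comp_hasDerivAt 0 (hY' j))
    have h2 : (fun t => (inner ℝ (X t i) ((Jc ∘ fun t => X t j) t) : ℝ)) =ᶠ[𝓝 0] fun _ => 0 := by
      filter_upwards [hX] with t ht
      exact ht.mem_isotropicFlags_iff.mp (hγ t) i j
    have h3 := h1.unique ((hasDerivAt_const (0 : ℝ) (0 : ℝ)).congr_of_eventuallyEq h2)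
    rw [add_comm] at h3
    exact h3
  exists_curve Y hY := by
    have h0 := inner_complexStr_coord u hπ hJ
    obtain ⟨Z, hZ, hZJ, hZe⟩ :=
      exists_skew_commuting (u.orthonormal.comp π π.injective) h0 hY
    have ho : ∀ t, Orthonormal ℝ fun i => NormedSpace.exp (t • Z) (u (π i)) := fun t => by
      rw [orthonormal_iff_ite]
      intro i j
      rw [inner_exp_of_skew hZ]
      exact orthonormal_iff_ite.mp (u.orthonormal.comp π π.injective) i j
    refine ⟨fun t i => NormedSpace.exp (t • Z) (u (π i)), ho,
      contDiff_pi.mpr fun i => contDiff_exp_apply Z _,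
      fun t => ofFrame_mem_isotropicFlags (ho t) fun i j => ?_, ?_,
      hasDerivAt_pi.mpr fun i => ?_⟩
    · rw [← exp_complexStr hZJ, inner_exp_of_skew hZ, h0]
    · funext i
      exact exp_zero_smul_apply Z _
    · rw [← hZe i]
      exact hasDerivAt_exp_apply Z _
  coord := spLinkCoord u π
  coord_inj _ hY h := spLinkCoord_injective u hε hJ hY h
  sets := spLinkSets π
  str_subset _ := Set.inter_subset_right
  str_subset_stratum _ := Set.inter_subset_left
  coord_eq_zero x z hzx Y hY := by
    obtain ⟨c, -, hc⟩ := spLinkVec_eq u hε hJ z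
    rw [spLinkCoord_apply, hc, real_inner_smul_left, hY _ _ (spLinkKey_notMem hπ hzx), mul_zero]
  smooth x := by
    rw [spLinkFrame_eq_rot]
    exact contDiff_rot _ _
  orthonormal := spLinkFrame_orthonormal u hπ hJ
  mem_str x t := by
    refine ⟨⟨_, isFrame_ofFrame _ _, fun i => ?_⟩,
      ofFrame_mem_isotropicFlags _ (spLinkFrame_isotropic u hπ hJ x t)⟩
    rw [spLinkFrame_eq_rot]
    exact rot_mem (e := fun i => u (π i)) (Submodule.subset_span (s := u '' spLinkSets π x i)
      ⟨_, self_mem_spLinkSets π x i, rfl⟩) (spLinkDir_mem_span u π hJ x i) t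
  frame_zero x := by
    rw [spLinkFrame_eq_rot]
    exact rot_zero _ _
  dir := spLinkDir u π
  hasDerivAt x := by
    rw [spLinkFrame_eq_rot]
    exact hasDerivAt_rot _ _
  coord_dir_self x := by
    obtain ⟨c, hcc, hc⟩ := spLinkVec_eq u hε hJ x
    rw [spLinkCoord_apply, spLinkDir_key, hc, real_inner_smul_left, real_inner_smul_right,
      u.inner_eq_one, mul_one, hcc]

/-! ### The values of the Hessian -/

variable {π}

theorem hform_spLinkDir {M : Matrix (Fin n ⊕ Fin n) (Fin n ⊕ Fin n) ℝ} {lam : Fin n ⊕ Fin n → ℝ}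
    (b : Fin k → ℝ) (hM : ∀ a, M.toEuclideanLin (u a) = lam a ^ 2 • u a) (hπ : IsIsotropic π)
    (hε : ∀ a, ε a * ε a = 1) (hJ : ∀ a, complexStr n (u a) = ε a • u a.swap) (x : SpLink π)
    (Y : Fin k → EuclideanSpace ℝ (Fin n ⊕ Fin n)) (hY : Y ∈ (spLinkSystem u π hπ hε hJ).K) :
    hform M b (fun i => lam (π i) ^ 2) ((spLinkSystem u π hπ hε hJ).dir x) Y =
      spLinkValue lam b π x * (spLinkSystem u π hπ hε hJ).coord Y x := by
  change hform M b (fun i => lam (π i) ^ 2) (spLinkDir u π x) Y =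
    spLinkValue lam b π x * spLinkCoord u π Y x
  rw [spLinkCoord_apply]
  rcases x with (i | p) | (p | p)
  · exact hform_single b _ (hM _) Y
  · exact hform_single b _ (hM _) Y
  · have hM' : M.toEuclideanLin (-u (π p.1.1)) = lam (π p.1.1) ^ 2 • -u (π p.1.1) := by
      rw [map_neg, hM, smul_neg]
    have h1 : (inner ℝ (Y p.1.1) (u (π p.1.2)) + inner ℝ (u (π p.1.1)) (Y p.1.2) : ℝ) = 0 :=
      hY.1 p.1.1 p.1.2
    rw [real_inner_comm] at h1
    rw [spLinkDir, map_add, LinearMap.add_apply, hform_single b _ (hM _), hform_single b _ hM',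
      inner_neg_left, spLinkValue]
    simp only [spLinkKey, spLinkVec]
    linear_combination (-2 * (k : ℝ)⁻¹ * b p.1.2 ^ 2 * (lam (π p.1.1) ^ 2 - lam (π p.1.2) ^ 2)) * h1
  -- The symplectic relation gives `⟨J u_{π_i}, Y_j⟩ = ⟨J u_{π_j}, Y_i⟩`, so the two contributions
  -- add up on one coordinate.
  · have hMJ : ∀ a, M.toEuclideanLin (complexStr n (u a)) = lam a.swap ^ 2 • complexStr n (u a) :=
      fun a => by rw [hJ, map_smul, hM, smul_comm]
    have h1 : (inner ℝ (Y p.1.1) (complexStr n (u (π p.1.2))) +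
      inner ℝ (u (π p.1.1)) (complexStr n (Y p.1.2)) : ℝ) = 0 := hY.2 p.1.1 p.1.2
    rw [real_inner_comm] at h1
    rw [spLinkDir, map_add, LinearMap.add_apply, hform_single b _ (hMJ _),
      hform_single b _ (hMJ _), spLinkValue, inner_complexStr_left (u (π p.1.1))]
    simp only [spLinkKey, spLinkVec]
    linear_combination
      (-2 * (k : ℝ)⁻¹ * b p.1.2 ^ 2 * (lam (π p.1.1).swap ^ 2 - lam (π p.1.2) ^ 2)) * h1

variable {lam : Fin n ⊕ Fin n → ℝ} {b : Fin k → ℝ}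

/-- Since conjugate eigenvalues are inverse, the difference weighted by `b_j²` is
`(λ_{π_j}/λ_{π_i})²` times the one weighted by `b_i²`. The sum thus has the sign of a single
difference. -/
theorem spLinkValue_inr_inr (hlam : ∀ a, 0 < lam a) (hsw : ∀ a, lam a * lam a.swap = 1)
    (p : {p : Fin k × Fin k // p.1 < p.2}) :
    spLinkValue lam b π (.inr (.inr p)) =
      2 * (k : ℝ)⁻¹ * (b p.1.1 ^ 2 + b p.1.2 ^ 2 * (lam (π p.1.2) / lam (π p.1.1)) ^ 2) *
        (lam (π p.1.2).swap ^ 2 - lam (π p.1.1) ^ 2) := by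
  have h1 := hlam (π p.1.1)
  have h2 := hlam (π p.1.2)
  rw [spLinkValue, eq_one_div_of_mul_eq_one_right (hsw (π p.1.1)),
    eq_one_div_of_mul_eq_one_right (hsw (π p.1.2))]
  field_simp

/-- The last family of values differs by a positive factor from its rescaled form. -/
theorem exists_rescale (hb : ∀ i, 0 < b i) (hb' : StrictAnti b) (hlam : ∀ a, 0 < lam a)
    (hsw : ∀ a, lam a * lam a.swap = 1) (x : SpLink π) :
    ∃ r : ℝ, r ≠ 0 ∧ r ^ 2 * spLinkValue lam b π x = spLinkValueRescaled lam b π x := by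
  rcases x with (i | p) | (p | p)
  · exact ⟨1, one_ne_zero, by rw [one_pow, one_mul]; rfl⟩
  · exact ⟨1, one_ne_zero, by rw [one_pow, one_mul]; rfl⟩
  · exact ⟨1, one_ne_zero, by rw [one_pow, one_mul]; rfl⟩
  · have h1 := hb p.1.1
    have h2 : 0 < b p.1.1 ^ 2 - b p.1.2 ^ 2 :=
      sub_pos.mpr (pow_lt_pow_left₀ (hb' p.2) (hb _).le two_ne_zero)
    have h3 : 0 < b p.1.1 ^ 2 + b p.1.2 ^ 2 * (lam (π p.1.2) / lam (π p.1.1)) ^ 2 := by positivity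
    -- The square root of the ratio of the desired positive factor to the one in
    -- `spLinkValue_inr_inr`.
    refine ⟨√((b p.1.1 ^ 2 - b p.1.2 ^ 2) /
      (b p.1.1 ^ 2 + b p.1.2 ^ 2 * (lam (π p.1.2) / lam (π p.1.1)) ^ 2)),
      (Real.sqrt_pos.mpr (div_pos h2 h3)).ne', ?_⟩
    rw [Real.sq_sqrt (div_pos h2 h3).le, spLinkValue_inr_inr hlam hsw, spLinkValueRescaled]
    generalize b p.1.1 ^ 2 + b p.1.2 ^ 2 * (lam (π p.1.2) / lam (π p.1.1)) ^ 2 = d at h3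
    field_simp

theorem spLinkValue_eq (hb : ∀ i, 0 < b i) (hb' : StrictAnti b) (hlam : ∀ a, 0 < lam a)
    (hsw : ∀ a, lam a * lam a.swap = 1) (x : SpLink π) :
    ∃ c : ℝ, 0 < c ∧ spLinkValue lam b π x =
      c * (lam (spLinkKey π x).2 ^ 2 - lam (π (spLinkKey π x).1) ^ 2) := by
  have hk : 0 < (k : ℝ)⁻¹ := inv_pos.mpr (Nat.cast_pos.mpr (spLinkKey π x).1.pos)
  rcases x with (i | p) | (p | p)
  · exact ⟨_, mul_pos (mul_pos two_pos hk) (pow_pos (hb _) 2), rfl⟩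
  · exact ⟨_, mul_pos (mul_pos two_pos hk) (pow_pos (hb _) 2), rfl⟩
  · exact ⟨_, mul_pos (mul_pos two_pos hk)
      (sub_pos.mpr (pow_lt_pow_left₀ (hb' p.2) (hb _).le two_ne_zero)), rfl⟩
  · have h1 := hb p.1.1
    exact ⟨_, mul_pos (mul_pos two_pos hk) (by positivity), spLinkValue_inr_inr hlam hsw p⟩

theorem spLinkValue_pos (hb : ∀ i, 0 < b i) (hb' : StrictAnti b) (hlam : ∀ a, 0 < lam a)
    (hsw : ∀ a, lam a * lam a.swap = 1) {x : SpLink π}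
    (h : lam (π (spLinkKey π x).1) < lam (spLinkKey π x).2) : 0 < spLinkValue lam b π x := by
  obtain ⟨c, hc, hx⟩ := spLinkValue_eq hb hb' hlam hsw x
  rw [hx]
  exact mul_pos hc (sub_pos.mpr (pow_lt_pow_left₀ h (hlam _).le two_ne_zero))

theorem spLinkValue_neg (hb : ∀ i, 0 < b i) (hb' : StrictAnti b) (hlam : ∀ a, 0 < lam a)
    (hsw : ∀ a, lam a * lam a.swap = 1) {x : SpLink π}
    (h : lam (spLinkKey π x).2 < lam (π (spLinkKey π x).1)) : spLinkValue lam b π x < 0 := by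
  obtain ⟨c, hc, hx⟩ := spLinkValue_eq hb hb' hlam hsw x
  rw [hx]
  exact mul_neg_of_pos_of_neg hc (sub_neg.mpr (pow_lt_pow_left₀ h (hlam _).le two_ne_zero))

theorem spLT_or_spLT {a c : Fin n ⊕ Fin n} (h : a ≠ c) : SpLT a c ∨ SpLT c a := by
  rcases a with a | a <;> rcases c with c | c
  · exact lt_or_gt_of_ne fun h' => h (congrArg _ h')
  · exact Or.inl trivial
  · exact Or.inr trivial
  · exact (lt_or_gt_of_ne fun h' => h (congrArg _ h')).symm

/-! ### Counting -/

theorem card_spLink (hπ : IsIsotropic π) : Nat.card (SpLink π) = k * (2 * n - k) := by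
  have hf : Function.Injective (Sum.elim π fun i => (π i).swap) :=
    π.injective.sumElim (swap_injective.comp π.injective) fun i j => (hπ.swap_ne j i).symm
  have h1 := card_notMem_range hf
  have h2 : ∀ a, a ∉ Set.range (Sum.elim π fun i => (π i).swap) ↔
      a ∉ Set.range π ∧ a.swap ∉ Set.range π := by
    intro a
    rw [Set.Sum.elim_range, Set.mem_union, not_or]
    refine and_congr_right fun _ => not_congr ⟨?_, ?_⟩
    · rintro ⟨i, rfl⟩
      exact ⟨i, (Sum.swap_swap _).symm⟩
    · rintro ⟨i, hi⟩
      exact ⟨i, by simp only [hi, Sum.swap_swap]⟩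
  simp only [h2] at h1
  have h3 := card_lt_pairs k
  rw [Nat.card_sum, Nat.card_sum, Nat.card_sum,
    card_pairs (fun j => j ∉ Set.range π ∧ j.swap ∉ Set.range π)]
  simp only [Nat.card_sum, Nat.card_eq_fintype_card (α := Fin _), Fintype.card_fin] at h1 ⊢
  generalize Nat.card {a // a ∉ Set.range π ∧ a.swap ∉ Set.range π} = m at h1
  -- Here `m = 2n - 2k`, so the total is `k + km + k(k - 1) = k(m + k)`.
  rw [show 2 * n - k = m + k by omega]
  rcases k with - | k
  · simp
  · rw [Nat.add_sub_cancel] at h3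
    linarith

theorem card_spLink_inversions :
    Nat.card {x : SpLink π // SpLT (spLinkKey π x).2 (π (spLinkKey π x).1)} =
      spInversionCount π := by
  rw [card_sum_subtype, card_sum_subtype, card_sum_subtype]
  simp only [spLinkKey]
  rw [card_subtype_subtype (fun p : Fin k × (Fin n ⊕ Fin n) =>
      p.2 ∉ Set.range π ∧ p.2.swap ∉ Set.range π) fun p => SpLT p.2 (π p.1),
    card_subtype_subtype (fun p : Fin k × Fin k => p.1 < p.2) fun p => SpLT (π p.2) (π p.1),
    card_subtype_subtype (fun p : Fin k × Fin k => p.1 < p.2) fun p => SpLT (π p.2).swap (π p.1)]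
  simp only [and_assoc, spInversionCount, add_assoc]

end Symplectic

end KFlag

end

/-! ### The proposition for both flag manifolds. -/

theorem mainTheorem4 (n k : ℕ) (b : Fin k → ℝ) (hb : ∀ i, 0 < b i) :
    -- the flag manifold of `ℝⁿ`
    (∀ (u : OrthonormalBasis (Fin n) ℝ (EuclideanSpace ℝ (Fin n)))
        (A : Matrix (Fin n) (Fin n) ℝ) (lam : Fin n → ℝ) (π : Fin k ↪ Fin n),
      A.det = 1 → (∀ a, 0 < lam a) → (∀ a, A.toEuclideanLin (u a) = lam a • u a) →
      KFlag.IsCriticalAt Set.univ (KFlag.quadFun (A.transpose * A) b) (KFlag.coordFlag u π) ∧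
      Module.finrank ℝ (KFlag.tangentSpace Set.univ (KFlag.coordFlag u π)) =
        k * (2 * n - k - 1) / 2 ∧
      ∃ (B : LinearMap.BilinForm ℝ (KFlag.tangentSpace Set.univ (KFlag.coordFlag u π)))
        (w : Module.Basis (KFlag.Link π) ℝ (KFlag.tangentSpace Set.univ (KFlag.coordFlag u π))),
        -- `B` is the Hessian
        KFlag.IsHessianAt Set.univ (KFlag.quadFun (A.transpose * A) b) (KFlag.coordFlag u π) B ∧
        (∀ B', KFlag.IsHessianAt Set.univ (KFlag.quadFun (A.transpose * A) b)
          (KFlag.coordFlag u π) B' → B' = B) ∧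
        -- `w` is the eigenvector basis of the velocities by rotation angle
        KFlag.IsEigenvectorBasis Set.univ (KFlag.coordFlag u π)
          (fun x => KFlag.stratum u (KFlag.linkSets π x)) w ∧
        (∃ c : KFlag.Link π → ℝ → KFlag (Fin n) k,
          (∀ x t, KFlag.IsFrame (KFlag.linkFrame u π x t) (c x t)) ∧
          ∀ x, HasDerivAt (fun t => (c x t).proj) (w x).1 0) ∧
        (∀ x, B (w x) (w x) = KFlag.linkValue lam b π x) ∧
        -- any eigenvector basis diagonalizes the Hessian
        ∀ v : Module.Basis (KFlag.Link π) ℝ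
            (KFlag.tangentSpace Set.univ (KFlag.coordFlag u π)),
          KFlag.IsEigenvectorBasis Set.univ (KFlag.coordFlag u π)
            (fun x => KFlag.stratum u (KFlag.linkSets π x)) v →
          (∀ x y, x ≠ y → B (v x) (v y) = 0) ∧
          (∀ x, ∃ r : ℝ, r ≠ 0 ∧ v x = r • w x ∧
            B (v x) (v x) = r ^ 2 * KFlag.linkValue lam b π x) ∧
          (StrictAnti b → StrictAnti lam →
            Nat.card {x // 0 < B (v x) (v x)} = KFlag.inversionCount π ∧
            Nat.card {x // B (v x) (v x) < 0} + KFlag.inversionCount π =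
              k * (2 * n - k - 1) / 2) ∧
          (StrictAnti b → StrictMono lam →
            Nat.card {x // B (v x) (v x) < 0} = KFlag.inversionCount π ∧
            Nat.card {x // 0 < B (v x) (v x)} + KFlag.inversionCount π =
              k * (2 * n - k - 1) / 2)) ∧
    -- the isotropic flag manifold of `ℝ²ⁿ`
    (∀ (u : OrthonormalBasis (Fin n ⊕ Fin n) ℝ (EuclideanSpace ℝ (Fin n ⊕ Fin n)))
        (A : Matrix (Fin n ⊕ Fin n) (Fin n ⊕ Fin n) ℝ) (lam : Fin n ⊕ Fin n → ℝ)
        (π : Fin k ↪ Fin n ⊕ Fin n),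
      (∀ a : Fin n, (Submodule.span ℝ {u (Sum.inl a)}).map (KFlag.complexStr n) =
        Submodule.span ℝ {u (Sum.inr a)}) →
      A ∈ Matrix.symplecticGroup (Fin n) ℝ → (∀ a, 0 < lam a) →
      (∀ a, A.toEuclideanLin (u a) = lam a • u a) → KFlag.IsIsotropic π →
      KFlag.coordFlag u π ∈ KFlag.isotropicFlags n k ∧
      KFlag.IsCriticalAt (KFlag.isotropicFlags n k) (KFlag.quadFun (A.transpose * A) b)
        (KFlag.coordFlag u π) ∧
      Module.finrank ℝ (KFlag.tangentSpace (KFlag.isotropicFlags n k) (KFlag.coordFlag u π)) =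
        k * (2 * n - k) ∧
      ∃ (B : LinearMap.BilinForm ℝ
          (KFlag.tangentSpace (KFlag.isotropicFlags n k) (KFlag.coordFlag u π)))
        (w : Module.Basis (KFlag.SpLink π) ℝ
          (KFlag.tangentSpace (KFlag.isotropicFlags n k) (KFlag.coordFlag u π))),
        -- `B` is the Hessian
        KFlag.IsHessianAt (KFlag.isotropicFlags n k) (KFlag.quadFun (A.transpose * A) b)
          (KFlag.coordFlag u π) B ∧
        (∀ B', KFlag.IsHessianAt (KFlag.isotropicFlags n k)
          (KFlag.quadFun (A.transpose * A) b) (KFlag.coordFlag u π) B' → B' = B) ∧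
        -- `w` is the eigenvector basis of the velocities by rotation angle
        KFlag.IsEigenvectorBasis (KFlag.isotropicFlags n k) (KFlag.coordFlag u π)
          (fun x => KFlag.stratum u (KFlag.spLinkSets π x) ∩ KFlag.isotropicFlags n k) w ∧
        (∃ c : KFlag.SpLink π → ℝ → KFlag (Fin n ⊕ Fin n) k,
          (∀ x t, KFlag.IsFrame (KFlag.spLinkFrame u π x t) (c x t)) ∧
          ∀ x, HasDerivAt (fun t => (c x t).proj) (w x).1 0) ∧
        (∀ x, B (w x) (w x) = KFlag.spLinkValue lam b π x) ∧
        -- an eigenvector basis with the rescaled values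
        (StrictAnti b → Function.Injective lam →
          ∃ v : Module.Basis (KFlag.SpLink π) ℝ
              (KFlag.tangentSpace (KFlag.isotropicFlags n k) (KFlag.coordFlag u π)),
            KFlag.IsEigenvectorBasis (KFlag.isotropicFlags n k) (KFlag.coordFlag u π)
              (fun x => KFlag.stratum u (KFlag.spLinkSets π x) ∩ KFlag.isotropicFlags n k) v ∧
            ∀ x, B (v x) (v x) = KFlag.spLinkValueRescaled lam b π x) ∧
        -- any eigenvector basis diagonalizes the Hessian
        ∀ v : Module.Basis (KFlag.SpLink π) ℝ
            (KFlag.tangentSpace (KFlag.isotropicFlags n k) (KFlag.coordFlag u π)),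
          KFlag.IsEigenvectorBasis (KFlag.isotropicFlags n k) (KFlag.coordFlag u π)
            (fun x => KFlag.stratum u (KFlag.spLinkSets π x) ∩ KFlag.isotropicFlags n k) v →
          (∀ x y, x ≠ y → B (v x) (v y) = 0) ∧
          (∀ x, ∃ r : ℝ, r ≠ 0 ∧ v x = r • w x ∧
            B (v x) (v x) = r ^ 2 * KFlag.spLinkValue lam b π x) ∧
          (StrictAnti b → (∀ a a', KFlag.SpLT a a' → lam a' < lam a) →
            Nat.card {x // 0 < B (v x) (v x)} = KFlag.spInversionCount π ∧
            Nat.card {x // B (v x) (v x) < 0} + KFlag.spInversionCount π =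
              k * (2 * n - k)) ∧
          (StrictAnti b → (∀ a a', KFlag.SpLT a a' → lam a < lam a') →
            Nat.card {x // B (v x) (v x) < 0} = KFlag.spInversionCount π ∧
            Nat.card {x // 0 < B (v x) (v x)} + KFlag.spInversionCount π =
              k * (2 * n - k))) := by 
  refine ⟨fun u A lam π _ hlam hA => ?_, ?_⟩
  · let L := KFlag.linkSystem u π
    have hM := KFlag.gram_symm A
    have hμ : ∀ i, (A.transpose * A).toEuclideanLin (u (π i)) = lam (π i) ^ 2 • u (π i) :=
      fun i => KFlag.gram_eigen hA (π i)
    have hval := KFlag.hform_linkDir u π b (KFlag.gram_eigen hA)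
    have hH := L.isHessianAt (μ := fun i => lam (π i) ^ 2) hb hM hμ
    refine ⟨L.isCriticalAt (μ := fun i => lam (π i) ^ 2) hb hM hμ,
      L.finrank_tangentSpace.trans (KFlag.card_link π), _, L.basis, hH,
      fun B' hB' => L.eq_of_isHessianAt hH hB', L.isEigenvectorBasis_basis, L.exists_circles,
      fun x => (L.hessian_basis hval x x).trans (if_pos rfl), fun v hv => ?_⟩
    have hd := L.hessian_diagonal hval hv
    have hq := fun x => (hd.2 x).imp fun r hr => And.intro hr.1 hr.2.2
    refine ⟨hd.1, hd.2, fun hb' hl => ?_, fun hb' hl => ?_⟩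
    · rw [← KFlag.card_link_inversions, ← KFlag.card_link π]
      -- A key that is not an inversion satisfies the reverse strict inequality, since its direction
      -- differs from the line it moves (`linkKey_ne`).
      exact KFlag.card_pos_neg hq
        (fun x hx => KFlag.linkValue_pos hb hb' hlam (hl hx))
        (fun x hx => KFlag.linkValue_neg hb hb' hlam
          (hl (lt_of_le_of_ne (not_lt.mp hx) (KFlag.linkKey_ne π x).symm)))
    · rw [← KFlag.card_link_inversions, ← KFlag.card_link π]
      exact KFlag.card_neg_pos hq
        (fun x hx => KFlag.linkValue_neg hb hb' hlam (hl hx))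
        (fun x hx => KFlag.linkValue_pos hb hb' hlam
          (hl (lt_of_le_of_ne (not_lt.mp hx) (KFlag.linkKey_ne π x).symm)))
  · intro u A lam π hu hA hlam hAu hπ
    obtain ⟨ε, hε, hJ⟩ := KFlag.exists_complexStr_basis hu
    have hsw := KFlag.eigenvalue_mul_swap hε hJ hA hAu
    let L := KFlag.spLinkSystem u π hπ hε hJ
    have hM := KFlag.gram_symm A
    have hμ : ∀ i, (A.transpose * A).toEuclideanLin (u (π i)) = lam (π i) ^ 2 • u (π i) :=
      fun i => KFlag.gram_eigen hAu (π i)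
    have hval := KFlag.hform_spLinkDir u b (KFlag.gram_eigen hAu) hπ hε hJ
    have hH := L.isHessianAt (μ := fun i => lam (π i) ^ 2) hb hM hμ
    refine ⟨KFlag.ofFrame_mem_isotropicFlags _ (KFlag.inner_complexStr_coord u hπ hJ),
      L.isCriticalAt (μ := fun i => lam (π i) ^ 2) hb hM hμ,
      L.finrank_tangentSpace.trans (KFlag.card_spLink hπ), _, L.basis, hH,
      fun B' hB' => L.eq_of_isHessianAt hH hB', L.isEigenvectorBasis_basis, L.exists_circles,
      fun x => (L.hessian_basis hval x x).trans (if_pos rfl), fun hb' _ => ?_, fun v hv => ?_⟩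
    · choose r hr hrv using KFlag.exists_rescale (π := π) hb hb' hlam hsw
      -- Scaling a basis vector by `r x` multiplies its diagonal entry by `r x ^ 2`, which is the
      -- rescaling factor.
      refine ⟨L.basis.isUnitSMul fun x => (hr x).isUnit, fun x => ?_, fun x => ?_⟩
      · rw [Module.Basis.isUnitSMul_apply]
        exact Submodule.smul_mem _ _ (L.isEigenvectorBasis_basis x)
      · rw [Module.Basis.isUnitSMul_apply, LinearMap.BilinForm.smul_left,
          LinearMap.BilinForm.smul_right, L.hessian_basis hval, if_pos rfl, ← hrv x, sq, mul_assoc]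
    · have hd := L.hessian_diagonal hval hv
      have hq := fun x => (hd.2 x).imp fun r hr => And.intro hr.1 hr.2.2
      have hinv := fun x (hx : ¬ KFlag.SpLT (KFlag.spLinkKey π x).2 (π (KFlag.spLinkKey π x).1)) =>
        (KFlag.spLT_or_spLT (KFlag.spLinkKey_ne hπ x)).resolve_left hx
      refine ⟨hd.1, hd.2, fun hb' hl => ?_, fun hb' hl => ?_⟩
      · rw [← KFlag.card_spLink_inversions, ← KFlag.card_spLink hπ]
        exact KFlag.card_pos_neg hq
          (fun x hx => KFlag.spLinkValue_pos hb hb' hlam hsw (hl _ _ hx))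
          (fun x hx => KFlag.spLinkValue_neg hb hb' hlam hsw (hl _ _ (hinv x hx)))
      · rw [← KFlag.card_spLink_inversions, ← KFlag.card_spLink hπ]
        exact KFlag.card_neg_pos hq
          (fun x hx => KFlag.spLinkValue_neg hb hb' hlam hsw (hl _ _ hx))
          (fun x hx => KFlag.spLinkValue_pos hb hb' hlam hsw (hl _ _ (hinv x hx)))
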